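/- Let $d\ge 0$, $q\ge 1$. Let $\mathcal P$ be the set of probability distributions $P$ of $(X,Y,Z)$ on $[0,1]\times[0,1]\times[0,1]^d$ that are absolutely continuous with respect to Lebesgue measure, let $\mathcal P_0\subseteq\mathcal P$, and let $\mathcal H_0$ be the set of those $P\in\mathcal P_0$ for which $X$ and $Y$ are conditionally independent given $Z$. For each $P\in\mathcal P_0$ fix versions of the regular conditional distributions of $X$ and of $Y$ given $Z=z$, $z \in [0,1]^d$, with distribution functions $F_{X\mid Z}(t\mid z)$, $F_{Y\mid Z}(t\mid z)$ and quantile functions $Q_{X\mid Z}(\tau\mid z)=\inf\{t\in[0,1] : F_{X\mid Z}(t\mid z)\ge\tau\}$, and $Q_{Y\mid Z}$ likewise. Let $\phi=(\phi_1,\dots,\phi_q):[0,1]\to\mathbb R^q$ have Lipschitz continuous, linearly independent coordinate functions, with (closed) supports $\mathcal T_k\subset(0,1)$ and $\int_0^1\phi_k(u)\,du=0$, $\int_0^1\phi_k(u)^2\,du=1$ for $k=1,\dots,q$. Put $\tau_{\min}=\inf\bigcup_k\mathcal T_k$, $\tau_{\max}=\sup\bigcup_k\mathcal T_k$ and $\mathcal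 T=[\tau_{\min},\tau_{\max}]$. For $f:[0,1]\times[0,1]^d\to\mathbb R$ let $\|f\|_{\mathcal T,\infty}$, respectively $\|f\|_{\mathcal T^c,\infty}$, be the supremum in $[0,\infty]$ of $|f(t,z)|$ over $z\in[0,1]^d$ and over those $t\in[0,1]$ that lie in, respectively outside, the interval $[Q_{X\mid Z}(\tau_{\min}\mid z),Q_{X\mid Z}(\tau_{\max}\mid z)]$. Define $\|f\|_{\mathcal T,\infty}'$ and $\|f\|_{\mathcal T^c,\infty}'$ in the same way with $Q_{Y\mid Z}$. Let $(X_i,Y_i,Z_i)_{i=1}^n$ be an i.i.d. sample from $P$. Let $\hat F^{(n)}_{X\mid Z}$ and $\hat F^{(n)}_{Y\mid Z}$ be estimators of $F_{X\mid Z}$ and $F_{Y\mid Z}$ that do not depend on $P$ and are computed from $(X_i,Z_i)_{i=1}^n$ and from $(Y_i,Z_i)_{i=1}^n$, respectively. They take values in $[0,1]$, are increasing in $t$, and are jointly measurable in the sample, $t$ and $z$. For $[0,\infty]$-valued functions $R_n$ of the sample and numbers $a_n$, write $R_n\in\mathcal O_P(a_n)$ if for every $\epsilon>0$ there is $M>0$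 with $P(R_n>M|a_n|)\le\epsilon$ for all $n\ge1$ (outer probability if $R_n$ is not measurable). Assume that for each $P\in\mathcal P_0$ there are deterministic real sequences $g_P(n)\to0$, $h_P(n)\to0$ with $\sqrt n\,g_P(n)h_P(n)\to0$, and functions $\xi,\xi':[0,1]\times[0,1]^d\to\mathbb R$, such that (i) $\|F_{X\mid Z}-\hat F^{(n)}_{X\mid Z}\|_{\mathcal T,\infty}\in\mathcal O_P(g_P(n))$ and $\|F_{Y\mid Z}-\hat F^{(n)}_{Y\mid Z}\|_{\mathcal T,\infty}'\in\mathcal O_P(h_P(n))$; (ii) $\|\xi-\hat F^{(n)}_{X\mid Z}\|_{\mathcal T^c,\infty}\in\mathcal O_P(g_P(n))$ and $\|\xi'-\hat F^{(n)}_{Y\mid Z}\|_{\mathcal T^c,\infty}'\in\mathcal O_P(h_P(n))$. Let $\hat U_{1,i}=\hat F^{(n)}_{X\mid Z}(X_i\mid Z_i)$, $\hat U_{2,i}=\hat F^{(n)}_{Y\mid Z}(Y_i\mid Z_i)$, and $$\hat\rho_n=\frac1n\sum_{i=1}^n\phi(\hat U_{1,i})\phi(\hat U_{2,i})^T,\qquad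 \Sigma=\Big(\int_0^1\phi_k(u)\phi_s(u)\,du\Big)_{k,s=1}^q,\qquad T_n=\big\|\Sigma^{-1/2}\hat\rho_n\Sigma^{-1/2}\big\|_F^2,$$ where $\|\cdot\|_F$ is the Frobenius norm. For $\alpha\in(0,1)$ let $\hat\Psi_n=1(T_n>n^{-1}z_{1-\alpha})$, where $z_{1-\alpha}$ is the $(1-\alpha)$-quantile of the $\chi^2$-distribution with $q^2$ degrees of freedom. Then $\hat\Psi_n$ has asymptotic pointwise level $\alpha$ over $\mathcal H_0$: $$\limsup_{n\to\infty}E_P(\hat\Psi_n)=\alpha\qquad\text{for each } P\in\mathcal H_0.$$ -/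

import Mathlib

open MeasureTheory ProbabilityTheory Filter Topology
open scoped ENNReal unitInterval

noncomputable section

namespace PartialCopula

/-! ### The observation space and the distributions on it -/

/-- The cube `[0,1]^d` in which the conditioning variable `Z` takes its values. -/
abbrev Cube (d : ℕ) : Type := Fin d → I

/-- The space `[0,1]^{2+d}` of observations `(x, y, z)`. -/
abbrev Obs (d : ℕ) : Type := I × I × Cube d

/-- The coordinate `(x, y, z) ↦ x`. -/
def coordX (d : ℕ) (w : Obs d) : I := w.1

/-- The coordinate `(x, y, z) ↦ y`. -/
def coordY (d : ℕ) (w : Obs d) : I := w.2.1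

/-- The coordinate `(x, y, z) ↦ z`. -/
def coordZ (d : ℕ) (w : Obs d) : Cube d := w.2.2

lemma measurable_coordZ (d : ℕ) : Measurable (coordZ d) :=
  measurable_snd.comp measurable_snd

/-- The class `𝒫` of all probability distributions on `[0,1]^{2+d}` that are absolutely continuous
with respect to Lebesgue measure. -/
def absContLaws (d : ℕ) : Set (ProbabilityMeasure (Obs d)) :=
  {P | (P : Measure (Obs d)) ≪ volume}

/-- The class `ℋ ⊆ 𝒫` of those distributions for which `X` and `Y` are conditionally independent
given `Z`. -/
def condIndepLaws (d : ℕ) : Set (ProbabilityMeasure (Obs d)) :=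
  {P | P ∈ absContLaws d ∧
    CondIndepFun (MeasurableSpace.comap (coordZ d) inferInstance) (measurable_coordZ d).comap_le
      (coordX d) (coordY d) (P : Measure (Obs d))}

/-! ### Conditional distribution functions and conditional quantiles -/

/-- `κ` is a (version of the) regular conditional distribution of the `[0,1]`-valued variable `V`
given `Z`, when `(X, Y, Z)` has the law `P`. -/
def IsCondLaw {d : ℕ} (P : ProbabilityMeasure (Obs d)) (V : Obs d → I)
    (κ : Kernel (Cube d) I) : Prop :=
  IsMarkovKernel κ ∧
    ((P : Measure (Obs d)).map (fun w => (coordZ d w, V w))).IsCondKernel κ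

/-- The conditional distribution function `F(t | z)` that belongs to the conditional
distribution `κ`. -/
def cdfOf {d : ℕ} (κ : Kernel (Cube d) I) (t : I) (z : Cube d) : ℝ := (κ z).real (Set.Iic t)

/-- The conditional quantile function `Q(τ | z) = inf {t ∈ [0,1] | F(t | z) ≥ τ}`; the infimum is
taken in `[0,1]`. -/
def quantileOf {d : ℕ} (κ : Kernel (Cube d) I) (τ : I) (z : Cube d) : I :=
  sInf {t : I | (τ : ℝ) ≤ cdfOf κ t z}

/-! ### The function `φ` that defines the generalized correlation -/

/-- The standing assumptions on `φ = (φ_1, …, φ_q) : [0,1] → ℝ^q`. -/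
structure IsCorrelationMap {q : ℕ} (φ : Fin q → I → ℝ) : Prop where
  /-- The support of each `φ_k`, a closed and hence compact set, is contained in `(0,1)`. -/
  support_subset : ∀ k, tsupport (φ k) ⊆ Set.Ioo 0 1
  lipschitz : ∀ k, ∃ L, LipschitzWith L (φ k)
  integral_eq_zero : ∀ k, ∫ u, φ k u = 0
  integral_sq_eq_one : ∀ k, ∫ u, φ k u ^ 2 = 1
  linearIndependent : LinearIndependent ℝ φ

/-- `τ_min`, the infimum of the union of the supports of the `φ_k`. -/
def tauMin {q : ℕ} (φ : Fin q → I → ℝ) : I := sInf (⋃ k, tsupport (φ k))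

/-- `τ_max`, the supremum of the union of the supports of the `φ_k`. -/
def tauMax {q : ℕ} (φ : Fin q → I → ℝ) : I := sSup (⋃ k, tsupport (φ k))

/-- The range `Q(𝒯 | z) = [Q(τ_min | z), Q(τ_max | z)]` of conditional `𝒯`-quantiles,
where `𝒯 = [τ_min, τ_max]`. -/
def quantileRange {d q : ℕ} (φ : Fin q → I → ℝ) (κ : Kernel (Cube d) I) (z : Cube d) : Set I :=
  Set.Icc (quantileOf κ (tauMin φ) z) (quantileOf κ (tauMax φ) z)

/-- The supremum norm `‖f‖_{𝒯,∞}`: the supremum of `|f(t, z)|` over `z ∈ [0,1]^d` and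
`t ∈ Q(𝒯 | z)`, as an extended nonnegative real number. -/
def supNormInner {d q : ℕ} (φ : Fin q → I → ℝ) (κ : Kernel (Cube d) I)
    (f : I → Cube d → ℝ) : ℝ≥0∞ :=
  ⨆ (z : Cube d) (t ∈ quantileRange φ κ z), ENNReal.ofReal |f t z|

/-- The supremum norm `‖f‖_{𝒯ᶜ,∞}`: the supremum of `|f(t, z)|` over `z ∈ [0,1]^d` and
`t ∈ Q(𝒯ᶜ | z) = [0,1] \ Q(𝒯 | z)`, as an extended nonnegative real number. -/
def supNormOuter {d q : ℕ} (φ : Fin q → I → ℝ) (κ : Kernel (Cube d) I)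
    (f : I → Cube d → ℝ) : ℝ≥0∞ :=
  ⨆ (z : Cube d) (t ∈ (quantileRange φ κ z)ᶜ), ENNReal.ofReal |f t z|

/-! ### Samples and estimators -/

/-- The law of an i.i.d. sample of size `n` from `P`. -/
def sampleLaw {d : ℕ} (P : ProbabilityMeasure (Obs d)) (n : ℕ) : Measure (Fin n → Obs d) :=
  Measure.pi fun _ => (P : Measure (Obs d))

/-- An estimator `(F̂^{(n)})_n` of the conditional distribution function of a `[0,1]`-valued
variable `V` given `Z`: a rule that turns a sample `(V_i, Z_i)_{i ≤ n}` into a function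
`F̂^{(n)}(t | z)` with values in `[0,1]` that is increasing in `t`; it is measurable, jointly in
the sample, in `t` and in `z`. -/
structure CondCDFEstimator (d : ℕ) where
  /-- The estimate `F̂^{(n)}(t | z)` computed from the sample `s`. -/
  est : (n : ℕ) → (Fin n → I × Cube d) → I → Cube d → I
  measurable_est : ∀ n, Measurable
    fun p : (Fin n → I × Cube d) × I × Cube d => est n p.1 p.2.1 p.2.2
  monotone_est : ∀ n s z, Monotone fun t => est n s t z

/-- The estimate of `F_{X|Z}`, which is computed from `(X_i, Z_i)_{i ≤ n}`. -/
def CondCDFEstimator.estX {d : ℕ} (E : CondCDFEstimator d) (n : ℕ) (s : Fin n → Obs d) :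
    I → Cube d → I :=
  E.est n fun i => (coordX d (s i), coordZ d (s i))

/-- The estimate of `F_{Y|Z}`, which is computed from `(Y_i, Z_i)_{i ≤ n}`. -/
def CondCDFEstimator.estY {d : ℕ} (E : CondCDFEstimator d) (n : ℕ) (s : Fin n → Obs d) :
    I → Cube d → I :=
  E.est n fun i => (coordY d (s i), coordZ d (s i))

/-- `R_n ∈ 𝒪_P(a_n)` for a sequence of `[0,∞]`-valued statistics `R_n` of an i.i.d. sample from `P`
and a deterministic sequence `a_n`: for every `ε > 0` there is `M > 0` such that
`P(R_n > M |a_n|) ≤ ε` for all `n ≥ 1`. Where `R_n` is not measurable, this is outer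
probability. -/
def IsBigOInProb {d : ℕ} (P : ProbabilityMeasure (Obs d))
    (R : (n : ℕ) → (Fin n → Obs d) → ℝ≥0∞) (a : ℕ → ℝ) : Prop :=
  ∀ ε : ℝ, 0 < ε → ∃ M : ℝ, 0 < M ∧ ∀ n : ℕ, 1 ≤ n →
    sampleLaw P n {s | ENNReal.ofReal (M * |a n|) < R n s} ≤ ENNReal.ofReal ε

/-- Consistency of the estimators `EX` of `F_{X|Z}` and `EY` of `F_{Y|Z}` at the distribution `P`
with rate functions `g` and `h`, where `κX` and `κY` are the conditional distributions of `X` and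
of `Y` given `Z`. -/
structure IsConsistentWithRates {d q : ℕ} (φ : Fin q → I → ℝ) (EX EY : CondCDFEstimator d)
    (P : ProbabilityMeasure (Obs d)) (κX κY : Kernel (Cube d) I) (g h : ℕ → ℝ) : Prop where
  tendsto_left : Tendsto g atTop (𝓝 0)
  tendsto_right : Tendsto h atTop (𝓝 0)
  inner_left : IsBigOInProb P
    (fun n s => supNormInner φ κX fun t z => cdfOf κX t z - (EX.estX n s t z : ℝ)) g
  inner_right : IsBigOInProb P
    (fun n s => supNormInner φ κY fun t z => cdfOf κY t z - (EY.estY n s t z : ℝ)) h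
  outer : ∃ ξ ξ' : I → Cube d → ℝ,
    IsBigOInProb P
      (fun n s => supNormOuter φ κX fun t z => ξ t z - (EX.estX n s t z : ℝ)) g ∧
    IsBigOInProb P
      (fun n s => supNormOuter φ κY fun t z => ξ' t z - (EY.estY n s t z : ℝ)) h

/-! ### The test -/

/-- The empirical generalized correlation `ρ̂_n = n⁻¹ ∑_i φ(Û_{1,i}) φ(Û_{2,i})ᵀ`, where
`Û_{1,i} = F̂_{X|Z}(X_i | Z_i)` and `Û_{2,i} = F̂_{Y|Z}(Y_i | Z_i)`. -/
def rhoHat {d q : ℕ} (φ : Fin q → I → ℝ) (EX EY : CondCDFEstimator d) (n : ℕ)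
    (s : Fin n → Obs d) : Matrix (Fin q) (Fin q) ℝ :=
  Matrix.of fun k l => (n : ℝ)⁻¹ * ∑ i,
    φ k (EX.estX n s (coordX d (s i)) (coordZ d (s i))) *
      φ l (EY.estY n s (coordY d (s i)) (coordZ d (s i)))

/-- The matrix `Σ` with the entries `∫ φ_k(u) φ_s(u) du`. -/
def sigmaMat {q : ℕ} (φ : Fin q → I → ℝ) : Matrix (Fin q) (Fin q) ℝ :=
  Matrix.of fun k l => ∫ u, φ k u * φ l u

open scoped MatrixOrder in
/-- `Σ^{-1/2}`, the inverse of the positive semidefinite square root of `Σ`. -/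
def sigmaInvSqrt {q : ℕ} (φ : Fin q → I → ℝ) : Matrix (Fin q) (Fin q) ℝ :=
  (CFC.sqrt (sigmaMat φ))⁻¹

/-- The square `‖A‖_F²` of the Frobenius norm. -/
def frobeniusSq {q : ℕ} (A : Matrix (Fin q) (Fin q) ℝ) : ℝ := ∑ k, ∑ l, A k l ^ 2

/-- The test statistic `T_n = ‖Σ^{-1/2} ρ̂_n Σ^{-1/2}‖_F²`. -/
def testStat {d q : ℕ} (φ : Fin q → I → ℝ) (EX EY : CondCDFEstimator d) (n : ℕ)
    (s : Fin n → Obs d) : ℝ :=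
  frobeniusSq (sigmaInvSqrt φ * rhoHat φ EX EY n s * sigmaInvSqrt φ)

/-- The `χ²`-distribution with `k` degrees of freedom: the law of the sum of the squares of `k`
independent standard normal variables. -/
def chiSquared (k : ℕ) : Measure ℝ :=
  (Measure.pi fun _ : Fin k => gaussianReal 0 1).map fun x => ∑ i, x i ^ 2

/-- The `p`-quantile of a distribution on the real line. -/
def realQuantile (μ : Measure ℝ) (p : ℝ) : ℝ := sInf {t : ℝ | p ≤ μ.real (Set.Iic t)}

open Classical in
/-- The test `Ψ̂_n = 1(T_n > n⁻¹ z_{1-α})`, where `z_{1-α}` is the `(1-α)`-quantile of the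
`χ²`-distribution with `q²` degrees of freedom. -/
def correlationTest {d q : ℕ} (φ : Fin q → I → ℝ) (EX EY : CondCDFEstimator d) (α : ℝ) (n : ℕ)
    (s : Fin n → Obs d) : ℝ :=
  if (n : ℝ)⁻¹ * realQuantile (chiSquared (q ^ 2)) (1 - α) < testStat φ EX EY n s then 1 else 0

end PartialCopula

end

open PartialCopula

namespace PartialCopula

open Set

/-! ### Distribution functions -/

/-! Write `U₁ = F_{X|Z}(X|Z)` and `U₂ = F_{Y|Z}(Y|Z)`. Absolute continuity makes almost every
conditional law atomless, so under conditional independence `U₁` and `U₂` are independent and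
uniform (`map_cdfI`, `integral_apply_cdfI_mul_apply_cdfI`). The oracle correlation built from them
is an average of i.i.d. centred terms whose whitened entries are orthonormal. By the central limit
theorem, √n times its whitening tends to a standard Gaussian in dimension `q ^ 2`
(`tendstoInDistribution_oracle`), with squared norm of law χ².

It remains to replace the oracle by the estimate at scale √n. Writing `âb̂ - ab = (â-a)(b̂-b) +
a(b̂-b) + b(â-a)` leaves three sums. The product of errors is at most a constant times `√n |g h|`
with high probability (`tendsto_measure_error_mul_error`). In a mixed sum the estimation error for
`Y` depends on the sample only through the pairs `(Y_m, Z_m)`, given which the factors `φ(U₁)` are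
centred and uncorrelated. The sum then has second moment `o(n)` as soon as the error tends to zero,
at any speed (`tendsto_measure_oracle_mul_error`); the other mixed sum is symmetric.

Uniform control on the inner quantile range controls the error of `φ` everywhere: `φ` vanishes
outside `[τ_min, τ_max]`, and a monotone estimate is pinned at the two ends of the range
(`abs_apply_sub_apply_cdfI_le`). Slutsky's lemma, continuous mapping and the portmanteau theorem
then finish the proof, since χ² has no atoms. -/

lemma measureReal_Iic_mono (ν : Measure I) [IsFiniteMeasure ν] :
    Monotone fun t : I => ν.real (Iic t) :=
  fun _ _ h => measureReal_mono (Iic_subset_Iic.2 h)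

/-- Dominated convergence: as `t → t₀` the indicators of `Iic t` converge at every point except
`t₀`, which is null. -/
lemma continuous_measureReal_Iic {α : Type*} [LinearOrder α] [TopologicalSpace α] [OrderTopology α]
    [FirstCountableTopology α] [MeasurableSpace α] [OpensMeasurableSpace α] (ν : Measure α)
    [IsFiniteMeasure ν] [NullSingletonClass ν] : Continuous fun t : α => ν.real (Iic t) := by
  have h1 : (fun t : α => ν.real (Iic t)) =
      fun t => ∫ s, (Iic t).indicator (fun _ => (1 : ℝ)) s ∂ν := by
    funext t
    rw [integral_indicator measurableSet_Iic]
    simp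
  rw [h1, continuous_iff_continuousAt]
  intro t₀
  refine continuousAt_of_dominated (bound := fun _ => 1) ?_ ?_ (integrable_const _) ?_
  · exact Eventually.of_forall fun t =>
      (measurable_const.indicator measurableSet_Iic).aestronglyMeasurable
  · refine Eventually.of_forall fun t => Eventually.of_forall fun s => ?_
    by_cases h : s ∈ Iic t <;> simp [h]
  · have : ∀ᵐ s ∂ν, s ≠ t₀ := by
      simp [ae_iff]
    filter_upwards [this] with s hs
    rcases lt_or_gt_of_ne hs with h | h
    · refine (continuousAt_const (y := (1 : ℝ))).congr ?_
      filter_upwards [lt_mem_nhds h] with t ht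
      simp [ht.le]
    · refine (continuousAt_const (y := (0 : ℝ))).congr ?_
      filter_upwards [gt_mem_nhds h] with t ht
      simp [ht]

lemma exists_measureReal_Iic_eq (ν : Measure I) [IsProbabilityMeasure ν] [NullSingletonClass ν]
    (u : I) : ∃ t : I, ν.real (Iic t) = u := by
  have h0 : ν.real (Iic (0 : I)) = 0 := by
    have : Iic (0 : I) = {0} := by
      ext x
      simp
    simp [this, measureReal_def]
  have h1 : ν.real (Iic (1 : I)) = 1 := by
    have : Iic (1 : I) = univ := by
      ext x
      simp [unitInterval.le_one']
    simp [this]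
  have := mem_range_of_exists_le_of_exists_ge (continuous_measureReal_Iic ν) (c := (u : ℝ))
    ⟨0, by rw [h0]; exact u.2.1⟩ ⟨1, by rw [h1]; exact u.2.2⟩
  exact this

/-- The distribution function of a probability measure on the unit interval, as a map into the
unit interval. -/
noncomputable def cdfI (ν : Measure I) [IsProbabilityMeasure ν] (t : I) : I :=
  ⟨ν.real (Iic t), measureReal_nonneg, measureReal_le_one⟩

/-- The probability integral transform. -/
lemma map_cdfI (ν : Measure I) [IsProbabilityMeasure ν] [NullSingletonClass ν] :
    ν.map (cdfI ν) = volume := by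
  have hmeas : Measurable (cdfI ν) :=
    ((continuous_measureReal_Iic ν).subtype_mk _).measurable
  have : IsProbabilityMeasure (ν.map (cdfI ν)) :=
    Measure.isProbabilityMeasure_map hmeas.aemeasurable
  refine Measure.ext_of_Iic _ _ fun u => ?_
  rw [Measure.map_apply hmeas measurableSet_Iic, unitInterval.volume_Iic]
  obtain ⟨t, ht⟩ := exists_measureReal_Iic_eq ν u
  -- The distribution function may be flat at level `u`. Taking the greatest point with value at
  -- most `u` makes the preimage of `Iic u` exactly `Iic m`.
  obtain ⟨m, hm, hmax⟩ := IsCompact.exists_isGreatest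
    (s := {t : I | ν.real (Iic t) ≤ u})
    (isClosed_le (continuous_measureReal_Iic ν) continuous_const).isCompact ⟨t, ht.le⟩
  have hset : cdfI ν ⁻¹' Iic u = Iic m := by
    ext s
    refine ⟨fun hs => hmax hs, fun hs => ?_⟩
    exact (measureReal_Iic_mono ν hs).trans hm
  have heq : ν.real (Iic m) = u :=
    le_antisymm hm (ht.symm.le.trans (measureReal_Iic_mono ν (hmax ht.le)))
  rw [hset, ← heq, ofReal_measureReal]

/-! ### Correlation maps -/

section CorrelationMap

variable {q : ℕ} {φ : Fin q → I → ℝ}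

lemma IsCorrelationMap.continuous (hφ : IsCorrelationMap φ) (k : Fin q) : Continuous (φ k) :=
  (hφ.lipschitz k).choose_spec.continuous

lemma IsCorrelationMap.exists_lipschitz (hφ : IsCorrelationMap φ) :
    ∃ L : ℝ, 0 < L ∧ ∀ k u v, |φ k u - φ k v| ≤ L * |(u : ℝ) - v| := by
  choose K hK using hφ.lipschitz
  refine ⟨∑ k, (K k : ℝ) + 1, by positivity, fun k u v => ?_⟩
  have h := (hK k).dist_le_mul u v
  rw [Real.dist_eq, Subtype.dist_eq, Real.dist_eq] at h
  refine h.trans (mul_le_mul_of_nonneg_right ?_ (abs_nonneg _))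
  have : (K k : ℝ) ≤ ∑ k, (K k : ℝ) :=
    Finset.single_le_sum (f := fun k => (K k : ℝ)) (fun _ _ => NNReal.coe_nonneg _)
      (Finset.mem_univ k)
  linarith

lemma IsCorrelationMap.exists_bound (hφ : IsCorrelationMap φ) :
    ∃ C : ℝ, 0 < C ∧ ∀ k u, |φ k u| ≤ C := by
  have h : ∀ k, ∃ C : ℝ, ∀ u, |φ k u| ≤ C := fun k => by
    obtain ⟨C, hC⟩ := isCompact_univ.exists_bound_of_continuousOn (hφ.continuous k).continuousOn
    exact ⟨C, fun u => hC u (mem_univ u)⟩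
  choose C hC using h
  refine ⟨∑ k, |C k| + 1, by positivity, fun k u => ?_⟩
  have : |C k| ≤ ∑ k, |C k| :=
    Finset.single_le_sum (f := fun k => |C k|) (fun _ _ => abs_nonneg _) (Finset.mem_univ k)
  linarith [hC k u, le_abs_self (C k)]

lemma apply_eq_zero_of_lt_tauMin {k : Fin q} {u : I} (hu : u < tauMin φ) : φ k u = 0 := by
  by_contra h
  exact absurd (sInf_le (mem_iUnion.2 ⟨k, subset_tsupport _ h⟩)) (not_le.2 hu)

lemma apply_eq_zero_of_tauMax_lt {k : Fin q} {u : I} (hu : tauMax φ < u) : φ k u = 0 := by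
  by_contra h
  exact absurd (le_sSup (mem_iUnion.2 ⟨k, subset_tsupport _ h⟩)) (not_le.2 hu)

lemma nonempty_iUnion_tsupport (hq : 1 ≤ q) (hφ : IsCorrelationMap φ) :
    (⋃ k, tsupport (φ k)).Nonempty := by
  let k : Fin q := ⟨0, hq⟩
  by_contra h
  have h0 : ∀ u, φ k u = 0 := fun u => by
    by_contra hu
    exact h ⟨u, mem_iUnion.2 ⟨k, subset_tsupport _ hu⟩⟩
  have := hφ.integral_sq_eq_one k
  simp [h0] at this

lemma isCompact_iUnion_tsupport : IsCompact (⋃ k, tsupport (φ k)) :=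
  (isClosed_iUnion_of_finite fun k => isClosed_tsupport (φ k)).isCompact

lemma tauMin_mem (hq : 1 ≤ q) (hφ : IsCorrelationMap φ) : tauMin φ ∈ ⋃ k, tsupport (φ k) :=
  isCompact_iUnion_tsupport.sInf_mem (nonempty_iUnion_tsupport hq hφ)

lemma tauMax_mem (hq : 1 ≤ q) (hφ : IsCorrelationMap φ) : tauMax φ ∈ ⋃ k, tsupport (φ k) :=
  isCompact_iUnion_tsupport.sSup_mem (nonempty_iUnion_tsupport hq hφ)

lemma tauMin_pos (hq : 1 ≤ q) (hφ : IsCorrelationMap φ) : 0 < tauMin φ := by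
  obtain ⟨k, hk⟩ := mem_iUnion.1 (tauMin_mem hq hφ)
  exact (hφ.support_subset k hk).1

lemma tauMax_lt_one (hq : 1 ≤ q) (hφ : IsCorrelationMap φ) : tauMax φ < 1 := by
  obtain ⟨k, hk⟩ := mem_iUnion.1 (tauMax_mem hq hφ)
  exact (hφ.support_subset k hk).2

lemma tauMin_le_tauMax (hq : 1 ≤ q) (hφ : IsCorrelationMap φ) : tauMin φ ≤ tauMax φ :=
  le_sSup (tauMin_mem hq hφ)

/-- The endpoint itself follows by continuity, because `τ_min > 0` is a limit of points to its left.
-/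
lemma apply_eq_zero_of_le_tauMin (hq : 1 ≤ q) (hφ : IsCorrelationMap φ) {k : Fin q} {u : I}
    (hu : u ≤ tauMin φ) : φ k u = 0 := by
  have hcl : IsClosed {u | φ k u = 0} := isClosed_eq (hφ.continuous k) continuous_const
  have hsub : Iio (tauMin φ) ⊆ {u | φ k u = 0} := fun v hv => apply_eq_zero_of_lt_tauMin hv
  have := closure_minimal hsub hcl
  rw [closure_Iio' (a := tauMin φ) ⟨0, tauMin_pos hq hφ⟩] at this
  exact this hu

lemma apply_eq_zero_of_tauMax_le (hq : 1 ≤ q) (hφ : IsCorrelationMap φ) {k : Fin q} {u : I}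
    (hu : tauMax φ ≤ u) : φ k u = 0 := by
  have hcl : IsClosed {u | φ k u = 0} := isClosed_eq (hφ.continuous k) continuous_const
  have hsub : Ioi (tauMax φ) ⊆ {u | φ k u = 0} := fun v hv => apply_eq_zero_of_tauMax_lt hv
  have := closure_minimal hsub hcl
  rw [closure_Ioi' (a := tauMax φ) ⟨1, tauMax_lt_one hq hφ⟩] at this
  exact this hu

/-- `φ` vanishes to the left of `τ_min`, so it is small just to the right of it. -/
lemma abs_apply_le_of_le_tauMin_add (hq : 1 ≤ q) (hφ : IsCorrelationMap φ) {L : ℝ} (hL0 : 0 ≤ L)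
    (hL : ∀ k u v, |φ k u - φ k v| ≤ L * |(u : ℝ) - v|) (k : Fin q) {u : I} {δ : ℝ} (hδ : 0 ≤ δ)
    (hu : (u : ℝ) ≤ tauMin φ + δ) : |φ k u| ≤ L * δ := by
  rcases le_total u (tauMin φ) with h | h
  · rw [apply_eq_zero_of_le_tauMin hq hφ h]
    simpa using mul_nonneg hL0 hδ
  · have h1 := hL k u (tauMin φ)
    rw [apply_eq_zero_of_le_tauMin hq hφ le_rfl, sub_zero,
      abs_of_nonneg (sub_nonneg.2 (show (tauMin φ : ℝ) ≤ u from h))] at h1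
    exact h1.trans (mul_le_mul_of_nonneg_left (by linarith) hL0)

lemma abs_apply_le_of_tauMax_sub_le (hq : 1 ≤ q) (hφ : IsCorrelationMap φ) {L : ℝ} (hL0 : 0 ≤ L)
    (hL : ∀ k u v, |φ k u - φ k v| ≤ L * |(u : ℝ) - v|) (k : Fin q) {u : I} {δ : ℝ} (hδ : 0 ≤ δ)
    (hu : tauMax φ - δ ≤ (u : ℝ)) : |φ k u| ≤ L * δ := by
  rcases le_total (tauMax φ) u with h | h
  · rw [apply_eq_zero_of_tauMax_le hq hφ h]
    simpa using mul_nonneg hL0 hδ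
  · have h1 := hL k u (tauMax φ)
    rw [apply_eq_zero_of_tauMax_le hq hφ le_rfl, sub_zero, abs_sub_comm,
      abs_of_nonneg (sub_nonneg.2 (show (u : ℝ) ≤ tauMax φ from h))] at h1
    exact h1.trans (mul_le_mul_of_nonneg_left (by linarith) hL0)

variable {d : ℕ} (κ : Kernel (Cube d) I) [IsMarkovKernel κ]

lemma cdfOf_mono (z : Cube d) : Monotone fun t => cdfOf κ t z := measureReal_Iic_mono (κ z)

/-- Without atoms the distribution function is continuous, so the superlevel set is compact and its
infimum is attained. -/
lemma isLeast_quantileOf (z : Cube d) [NullSingletonClass (κ z)] (τ : I) :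
    IsLeast {t : I | (τ : ℝ) ≤ cdfOf κ t z} (quantileOf κ τ z) := by
  obtain ⟨t, ht⟩ := exists_measureReal_Iic_eq (κ z) τ
  have hc : IsCompact {t : I | (τ : ℝ) ≤ cdfOf κ t z} :=
    (isClosed_le continuous_const (continuous_measureReal_Iic (κ z))).isCompact
  exact hc.isLeast_sInf ⟨t, ht.ge⟩

lemma cdfOf_quantileOf (z : Cube d) [NullSingletonClass (κ z)] (τ : I) :
    cdfOf κ (quantileOf κ τ z) z = τ := by
  obtain ⟨t, ht⟩ := exists_measureReal_Iic_eq (κ z) τ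
  have h := isLeast_quantileOf κ z τ
  refine le_antisymm ?_ h.1
  exact (cdfOf_mono κ z (h.2 (show (τ : ℝ) ≤ cdfOf κ t z from ht.ge))).trans ht.le

/-- The transformed estimation error is controlled by the error on the conditional
`𝒯`-quantiles. -/
lemma abs_apply_sub_apply_cdfI_le (hq : 1 ≤ q) (hφ : IsCorrelationMap φ) {L : ℝ} (hL0 : 0 ≤ L)
    (hL : ∀ k u v, |φ k u - φ k v| ≤ L * |(u : ℝ) - v|) (k : Fin q) {F : I → Cube d → I}
    (hF : ∀ z, Monotone fun t => F t z) {δ : ℝ} (hδ : 0 ≤ δ)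
    (hsup : supNormInner φ κ (fun t z => cdfOf κ t z - (F t z : ℝ)) ≤ ENNReal.ofReal δ)
    (x : I) (z : Cube d) [NullSingletonClass (κ z)] :
    |φ k (F x z) - φ k (cdfI (κ z) x)| ≤ L * δ := by
  have hin : ∀ t ∈ quantileRange φ κ z, |cdfOf κ t z - (F t z : ℝ)| ≤ δ := fun t ht => by
    refine (ENNReal.ofReal_le_ofReal_iff hδ).1 (le_trans ?_ hsup)
    exact le_iSup_of_le z (le_iSup₂_of_le t ht le_rfl)
  have hmm : quantileOf κ (tauMin φ) z ≤ quantileOf κ (tauMax φ) z := by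
    refine (isLeast_quantileOf κ z _).2 ?_
    have h := (isLeast_quantileOf κ z (tauMax φ)).1
    exact le_trans (show (tauMin φ : ℝ) ≤ tauMax φ from tauMin_le_tauMax hq hφ) h
  -- Left of the range the true value of `φ` is zero, and monotonicity gives `F̂(x) ≤ F̂(Q(τ_min)) ≤
  -- τ_min + δ`. The right side is the mirror image; inside the range the Lipschitz bound applies
  -- directly.
  by_cases hx1 : x < quantileOf κ (tauMin φ) z
  · have h0 : φ k (cdfI (κ z) x) = 0 := by
      refine apply_eq_zero_of_le_tauMin hq hφ ?_
      change cdfOf κ x z ≤ tauMin φ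
      rw [← cdfOf_quantileOf κ z (tauMin φ)]
      exact cdfOf_mono κ z hx1.le
    rw [h0, sub_zero]
    refine abs_apply_le_of_le_tauMin_add hq hφ hL0 hL k hδ ?_
    have h1 := hin _ (left_mem_Icc.2 hmm)
    rw [cdfOf_quantileOf] at h1
    have h2 : (F x z : ℝ) ≤ F (quantileOf κ (tauMin φ) z) z := hF z hx1.le
    linarith [(abs_le.1 h1).1]
  by_cases hx2 : quantileOf κ (tauMax φ) z < x
  · have h0 : φ k (cdfI (κ z) x) = 0 := by
      refine apply_eq_zero_of_tauMax_le hq hφ ?_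
      change (tauMax φ : ℝ) ≤ cdfOf κ x z
      rw [← cdfOf_quantileOf κ z (tauMax φ)]
      exact cdfOf_mono κ z hx2.le
    rw [h0, sub_zero]
    refine abs_apply_le_of_tauMax_sub_le hq hφ hL0 hL k hδ ?_
    have h1 := hin _ (right_mem_Icc.2 hmm)
    rw [cdfOf_quantileOf] at h1
    have h2 : (F (quantileOf κ (tauMax φ) z) z : ℝ) ≤ F x z := hF z hx2.le
    linarith [(abs_le.1 h1).2]
  · refine (hL k _ _).trans (mul_le_mul_of_nonneg_left ?_ hL0)
    rw [abs_sub_comm]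
    exact hin x ⟨not_lt.1 hx1, not_lt.1 hx2⟩

lemma measurable_cdfI :
    Measurable fun p : I × Cube d => cdfI (κ p.2) p.1 := by
  refine Measurable.subtype_mk ?_
  have hs : MeasurableSet {p : (I × Cube d) × I | p.2 ≤ p.1.1} :=
    measurableSet_le measurable_snd (measurable_fst.comp measurable_fst)
  -- Pulling `κ` back along `Prod.snd` makes the threshold `t` part of the parameter, so that `Iic
  -- t` is a section of one measurable set.
  have h := Kernel.measurable_kernel_prodMk_left (κ := κ.comap Prod.snd measurable_snd) hs
  exact h.ennreal_toReal

end CorrelationMap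

/-! ### The whitening matrix -/

section Whitening

variable {q : ℕ} {φ : Fin q → I → ℝ}

lemma IsCorrelationMap.integrable_mul (hφ : IsCorrelationMap φ) (k l : Fin q) :
    Integrable fun u => φ k u * φ l u :=
  ((hφ.continuous k).mul (hφ.continuous l)).integrable_of_hasCompactSupport
    (HasCompactSupport.of_compactSpace _)

lemma IsCorrelationMap.integrable (hφ : IsCorrelationMap φ) (k : Fin q) :
    Integrable (φ k) :=
  (hφ.continuous k).integrable_of_hasCompactSupport (HasCompactSupport.of_compactSpace _)

/-- Used for the positive definiteness of `Σ`: a continuous nonnegative function that is not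
identically zero must have positive integral. -/
instance : (volume : Measure I).IsOpenPosMeasure := by
  refine ⟨fun U hU hne => ?_⟩
  obtain ⟨x, hx⟩ := hne
  intro h0
  have hd : Dense (Ioo (0 : I) 1) := by
    rw [dense_iff_closure_eq, closure_Ioo (by simp)]
    ext x
    simp [unitInterval.le_one']
  -- A point of `U` below `1` leaves room on its right for an interval of positive length.
  obtain ⟨y, hyU, hy⟩ := hd.inter_open_nonempty U hU ⟨x, hx⟩
  obtain ⟨a, ha, hab⟩ := exists_Ico_subset_of_mem_nhds (hU.mem_nhds hyU) ⟨1, hy.2⟩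
  have : volume (Ico y a) ≤ volume U := measure_mono hab
  rw [h0, unitInterval.volume_Ico] at this
  have h2 : (a : ℝ) - y ≤ 0 := ENNReal.ofReal_eq_zero.1 (le_antisymm this zero_le)
  have h3 : (y : ℝ) < a := ha
  linarith

/-- `Σ` is the Gram matrix of `φ` in `L²`. This serves both its positive definiteness and the
orthonormality of the whitened system. -/
lemma sum_sum_mul_sigmaMat (hφ : IsCorrelationMap φ) (a b : Fin q → ℝ) :
    ∑ k, ∑ l, a k * sigmaMat φ k l * b l
      = ∫ u, (∑ k, a k * φ k u) * (∑ l, b l * φ l u) := by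
  have h : (fun u => (∑ k, a k * φ k u) * (∑ l, b l * φ l u)) =
      fun u => ∑ k, ∑ l, (a k * b l) * (φ k u * φ l u) := by
    funext u
    rw [Finset.sum_mul_sum]
    exact Finset.sum_congr rfl fun k _ => Finset.sum_congr rfl fun l _ => by ring
  rw [h, integral_finsetSum]
  · refine Finset.sum_congr rfl fun k _ => ?_
    rw [integral_finsetSum]
    · refine Finset.sum_congr rfl fun l _ => ?_
      rw [integral_const_mul]
      simp [sigmaMat]
      ring
    · exact fun l _ => (hφ.integrable_mul k l).const_mul _
  · exact fun k _ => integrable_finsetSum _ fun l _ => (hφ.integrable_mul k l).const_mul _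

/-- The quadratic form is the integral of the square of a continuous function, which is nonzero by
linear independence. -/
lemma sigmaMat_posDef (hφ : IsCorrelationMap φ) : (sigmaMat φ).PosDef := by
  refine Matrix.PosDef.of_dotProduct_mulVec_pos ?_ fun v hv => ?_
  · ext k l
    simp [sigmaMat, mul_comm]
  · have h1 : star v ⬝ᵥ (sigmaMat φ).mulVec v = ∫ u, (∑ k, v k * φ k u) ^ 2 := by
      rw [show (fun u => (∑ k, v k * φ k u) ^ 2) =
        fun u => (∑ k, v k * φ k u) * (∑ k, v k * φ k u) from funext fun u => sq _,
        ← sum_sum_mul_sigmaMat hφ v v]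
      simp [dotProduct, Matrix.mulVec, Finset.mul_sum, mul_assoc]
    rw [h1]
    have hc : Continuous fun u => ∑ k, v k * φ k u :=
      continuous_finsetSum _ fun k _ => continuous_const.mul (hφ.continuous k)
    obtain ⟨u, hu⟩ : ∃ u, ∑ k, v k * φ k u ≠ 0 := by
      by_contra! h
      refine hv (funext fun k => ?_)
      refine Fintype.linearIndependent_iff.1 hφ.linearIndependent v ?_ k
      funext u
      simpa using h u
    exact (hc.pow 2).integral_pos_of_hasCompactSupport_nonneg_nonzero
      (HasCompactSupport.of_compactSpace _) (fun u => sq_nonneg _) (pow_ne_zero 2 hu)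

open scoped MatrixOrder in
-- With `S = √Σ`, `S * S = Σ` has nonzero determinant, so `S` is invertible and `S⁻¹ (S S) S⁻¹ = 1`.
lemma sigmaInvSqrt_mul_mul (hφ : IsCorrelationMap φ) :
    sigmaInvSqrt φ * sigmaMat φ * sigmaInvSqrt φ = 1 := by
  have hpos := sigmaMat_posDef hφ
  have hsq : CFC.sqrt (sigmaMat φ) * CFC.sqrt (sigmaMat φ) = sigmaMat φ :=
    CFC.sqrt_mul_sqrt_self _ hpos.posSemidef.nonneg
  have hdet : IsUnit (CFC.sqrt (sigmaMat φ)).det := by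
    have h := hpos.det_pos.ne'
    rw [← hsq, Matrix.det_mul] at h
    exact (left_ne_zero_of_mul h).isUnit
  unfold sigmaInvSqrt
  nth_rewrite 2 [← hsq]
  rw [Matrix.nonsing_inv_mul_cancel_left _ _ hdet, Matrix.mul_nonsing_inv _ hdet]

open scoped MatrixOrder in
lemma sigmaInvSqrt_transpose : (sigmaInvSqrt φ).transpose = sigmaInvSqrt φ := by
  unfold sigmaInvSqrt
  rw [Matrix.transpose_nonsing_inv]
  congr 1
  have h : (CFC.sqrt (sigmaMat φ)).IsHermitian := (Matrix.nonneg_iff_posSemidef.1 (CFC.sqrt_nonneg (sigmaMat φ))).1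
  rw [← Matrix.conjTranspose_eq_transpose_of_trivial]
  exact h

/-- The orthonormal system obtained from `φ` by whitening. -/
noncomputable def whitened (φ : Fin q → I → ℝ) (a : Fin q) (u : I) : ℝ :=
  ∑ k, sigmaInvSqrt φ a k * φ k u

lemma continuous_whitened (hφ : IsCorrelationMap φ) (a : Fin q) : Continuous (whitened φ a) :=
  continuous_finsetSum _ fun k _ => continuous_const.mul (hφ.continuous k)

lemma integral_whitened (hφ : IsCorrelationMap φ) (a : Fin q) : ∫ u, whitened φ a u = 0 := by
  unfold whitened
  rw [integral_finsetSum _ fun k _ => (hφ.integrable k).const_mul _]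
  simp [integral_const_mul, hφ.integral_eq_zero]

/-- This is the entry `(a, b)` of `Σ^{-1/2} Σ Σ^{-1/2} = 1`, read through the symmetry of
`Σ^{-1/2}`. -/
lemma integral_whitened_mul (hφ : IsCorrelationMap φ) (a b : Fin q) :
    ∫ u, whitened φ a u * whitened φ b u = if a = b then 1 else 0 := by
  unfold whitened
  rw [← sum_sum_mul_sigmaMat hφ]
  have h := congrFun (congrFun (sigmaInvSqrt_mul_mul hφ) a) b
  rw [Matrix.one_apply] at h
  rw [← h, Matrix.mul_apply, Finset.sum_comm]
  refine Finset.sum_congr rfl fun l _ => ?_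
  rw [Matrix.mul_apply, Finset.sum_mul]
  refine Finset.sum_congr rfl fun k _ => ?_
  have ht : sigmaInvSqrt φ b l = sigmaInvSqrt φ l b :=
    congrFun (congrFun (sigmaInvSqrt_transpose (φ := φ)) l) b
  rw [ht]

end Whitening

/-! ### The joint law under conditional independence -/

section JointLaw

variable {d : ℕ} {P : ProbabilityMeasure (Obs d)} {V W : Obs d → I} {κ η : Kernel (Cube d) I}

lemma IsCondLaw.map_eq_compProd (h : IsCondLaw P V κ) (hV : Measurable V) :
    (P : Measure (Obs d)).map (fun w => (coordZ d w, V w)) =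
      (P : Measure (Obs d)).map (coordZ d) ⊗ₘ κ := by
  have h1 := h.2.disintegrate
  rw [Measure.fst_map_prodMk hV] at h1
  exact h1.symm

/-- Conditional independence gives this factorization for `condDistrib`; almost sure uniqueness of
conditional laws carries it over to the fixed versions `κ` and `η`. -/
lemma map_eq_compProd_prod (hV : Measurable V) (hW : Measurable W) (hκ : IsCondLaw P V κ)
    (hη : IsCondLaw P W η)
    (hci : CondIndepFun (MeasurableSpace.comap (coordZ d) inferInstance)
      (measurable_coordZ d).comap_le V W (P : Measure (Obs d))) :
    (P : Measure (Obs d)).map (fun w => (coordZ d w, V w, W w)) =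
      (P : Measure (Obs d)).map (coordZ d) ⊗ₘ (κ ×ₖ η) := by
  have := hκ.1
  have := hη.1
  rw [(condIndepFun_iff_map_prod_eq_prod_condDistrib_prod_condDistrib hV hW
    (measurable_coordZ d)).1 hci, ← Measure.compProd_eq_comp_prod]
  refine Measure.compProd_congr ?_
  filter_upwards [condDistrib_ae_eq_of_measure_eq_compProd (coordZ d) hV.aemeasurable
    (hκ.map_eq_compProd hV), condDistrib_ae_eq_of_measure_eq_compProd (coordZ d) hW.aemeasurable
    (hη.map_eq_compProd hW)] with z h1 h2
  rw [Kernel.prod_apply, Kernel.prod_apply, h1, h2]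

/-- A joint law dominated by a product measure has conditional laws dominated by the second factor
for almost every `z`, and Lebesgue measure has no atoms. -/
lemma ae_nullSingletonClass (h : IsCondLaw P V κ) (hV : Measurable V)
    (hac : (P : Measure (Obs d)).map (fun w => (coordZ d w, V w)) ≪ volume) :
    ∀ᵐ z ∂(P : Measure (Obs d)).map (coordZ d), NullSingletonClass (κ z) := by
  have := h.1
  rw [h.map_eq_compProd hV, Measure.volume_eq_prod, ← Measure.compProd_const] at hac
  filter_upwards [hac.kernel_of_compProd] with z hz
  exact ⟨fun x => hz (by simp)⟩

lemma map_coordX_absolutelyContinuous (hP : P ∈ absContLaws d) :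
    (P : Measure (Obs d)).map (fun w => (coordZ d w, coordX d w)) ≪ volume := by
  have h : Measurable fun w : Obs d => (coordZ d w, coordX d w) :=
    (measurable_coordZ d).prodMk measurable_fst
  refine (Measure.AbsolutelyContinuous.map hP h).trans ?_
  have h1 : (volume : Measure (Obs d)).map (fun w => (w.2.2, w.1)) = volume := by
    rw [Measure.volume_eq_prod, Measure.volume_eq_prod I (Cube d)]
    have h2 : (fun w : Obs d => (w.2.2, w.1)) = Prod.swap ∘ Prod.map id Prod.snd := rfl
    rw [h2, ← Measure.map_map measurable_swap (by fun_prop), ← Measure.map_prod_map _ _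
      measurable_id measurable_snd]
    simp [Measure.prod_swap, Measure.volume_eq_prod]
  exact h1.le.absolutelyContinuous

lemma map_coordY_absolutelyContinuous (hP : P ∈ absContLaws d) :
    (P : Measure (Obs d)).map (fun w => (coordZ d w, coordY d w)) ≪ volume := by
  have h : Measurable fun w : Obs d => (coordZ d w, coordY d w) :=
    (measurable_coordZ d).prodMk (measurable_fst.comp measurable_snd)
  refine (Measure.AbsolutelyContinuous.map hP h).trans ?_
  have h1 : (volume : Measure (Obs d)).map (fun w => (w.2.2, w.2.1)) = volume := by
    have h2 : (fun w : Obs d => (w.2.2, w.2.1)) = Prod.swap ∘ Prod.snd := rfl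
    rw [h2, ← Measure.map_map measurable_swap measurable_snd, Measure.volume_eq_prod]
    simp [Measure.prod_swap, Measure.volume_eq_prod]
  exact h1.le.absolutelyContinuous

variable [IsMarkovKernel κ] [IsMarkovKernel η]

/-- The conditional probability integral transform makes `V` uniform and orthogonal to every
function of `(W, Z)`. -/
lemma integral_apply_cdfI_mul_eq_zero (hV : Measurable V) (hW : Measurable W)
    (hlaw : (P : Measure (Obs d)).map (fun w => (coordZ d w, V w, W w)) =
      (P : Measure (Obs d)).map (coordZ d) ⊗ₘ (κ ×ₖ η))
    (hatom : ∀ᵐ z ∂(P : Measure (Obs d)).map (coordZ d), NullSingletonClass (κ z))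
    {f : I → ℝ} (hf : Continuous f) (hf0 : ∫ u, f u = 0) {H : I × Cube d → ℝ}
    (hH : Measurable H) {C : ℝ} (hC : ∀ p, |H p| ≤ C) :
    ∫ w, f (cdfI (κ (coordZ d w)) (V w)) * H (W w, coordZ d w) ∂(P : Measure (Obs d)) = 0 := by
  obtain ⟨C', hC'⟩ := isCompact_univ.exists_bound_of_continuousOn hf.continuousOn
  have hmZ := measurable_coordZ d
  have hmeas : Measurable fun p : Cube d × I × I => f (cdfI (κ p.1) p.2.1) * H (p.2.2, p.1) := by
    refine Measurable.mul ?_ (hH.comp (by fun_prop))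
    exact hf.measurable.comp ((measurable_cdfI κ).comp
      (show Measurable fun p : Cube d × I × I => (p.2.1, p.1) by fun_prop))
  have h1 : ∫ w, f (cdfI (κ (coordZ d w)) (V w)) * H (W w, coordZ d w) ∂(P : Measure (Obs d)) =
      ∫ p, f (cdfI (κ p.1) p.2.1) * H (p.2.2, p.1)
        ∂((P : Measure (Obs d)).map (fun w => (coordZ d w, V w, W w))) := by
    rw [integral_map (by fun_prop) hmeas.aestronglyMeasurable]
  have : IsProbabilityMeasure ((P : Measure (Obs d)).map (coordZ d)) :=
    Measure.isProbabilityMeasure_map hmZ.aemeasurable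
  rw [h1, hlaw, Measure.integral_compProd]
  · refine integral_eq_zero_of_ae ?_
    filter_upwards [hatom] with z hz
    have hcdf : Measurable (cdfI (κ z)) :=
      ((continuous_measureReal_Iic (κ z)).subtype_mk _).measurable
    simp only [Kernel.prod_apply, Pi.zero_apply]
    -- For fixed `z` the integral factorizes, and the probability integral transform turns the first
    -- factor into `∫ f = 0`.
    rw [integral_prod_mul (fun x => f (cdfI (κ z) x)) (fun y => H (y, z)),
      ← integral_map (f := f) hcdf.aemeasurable hf.measurable.aestronglyMeasurable, map_cdfI, hf0,
      zero_mul]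
  · refine Integrable.of_bound hmeas.aestronglyMeasurable (C' * C) (ae_of_all _ fun p => ?_)
    rw [norm_mul]
    exact mul_le_mul (hC' _ (mem_univ _)) (hC _) (norm_nonneg _)
      ((norm_nonneg _).trans (hC' 0 (mem_univ _)))

/-- The partial copula is the independence copula under conditional independence. -/
lemma integral_apply_cdfI_mul_apply_cdfI (hV : Measurable V) (hW : Measurable W)
    (hlaw : (P : Measure (Obs d)).map (fun w => (coordZ d w, V w, W w)) =
      (P : Measure (Obs d)).map (coordZ d) ⊗ₘ (κ ×ₖ η))
    (hκa : ∀ᵐ z ∂(P : Measure (Obs d)).map (coordZ d), NullSingletonClass (κ z))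
    (hηa : ∀ᵐ z ∂(P : Measure (Obs d)).map (coordZ d), NullSingletonClass (η z))
    {f g : I → ℝ} (hf : Continuous f) (hg : Continuous g) :
    ∫ w, f (cdfI (κ (coordZ d w)) (V w)) * g (cdfI (η (coordZ d w)) (W w))
      ∂(P : Measure (Obs d)) = (∫ u, f u) * ∫ u, g u := by
  obtain ⟨C, hC⟩ := isCompact_univ.exists_bound_of_continuousOn hf.continuousOn
  obtain ⟨C', hC'⟩ := isCompact_univ.exists_bound_of_continuousOn hg.continuousOn
  have hmZ := measurable_coordZ d
  have hmeas : Measurable fun p : Cube d × I × I =>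
      f (cdfI (κ p.1) p.2.1) * g (cdfI (η p.1) p.2.2) := by
    refine Measurable.mul ?_ ?_
    · exact hf.measurable.comp ((measurable_cdfI κ).comp
        (show Measurable fun p : Cube d × I × I => (p.2.1, p.1) by fun_prop))
    · exact hg.measurable.comp ((measurable_cdfI η).comp
        (show Measurable fun p : Cube d × I × I => (p.2.2, p.1) by fun_prop))
  have h1 : ∫ w, f (cdfI (κ (coordZ d w)) (V w)) * g (cdfI (η (coordZ d w)) (W w))
        ∂(P : Measure (Obs d)) =
      ∫ p, f (cdfI (κ p.1) p.2.1) * g (cdfI (η p.1) p.2.2)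
        ∂((P : Measure (Obs d)).map (fun w => (coordZ d w, V w, W w))) := by
    rw [integral_map (by fun_prop) hmeas.aestronglyMeasurable]
  have : IsProbabilityMeasure ((P : Measure (Obs d)).map (coordZ d)) :=
    Measure.isProbabilityMeasure_map hmZ.aemeasurable
  rw [h1, hlaw, Measure.integral_compProd]
  · have h2 : ∀ᵐ z ∂(P : Measure (Obs d)).map (coordZ d),
        ∫ p, f (cdfI (κ z) p.1) * g (cdfI (η z) p.2) ∂(κ ×ₖ η) z = (∫ u, f u) * ∫ u, g u := by
      filter_upwards [hκa, hηa] with z hz hz'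
      have hcκ : Measurable (cdfI (κ z)) :=
        ((continuous_measureReal_Iic (κ z)).subtype_mk _).measurable
      have hcη : Measurable (cdfI (η z)) :=
        ((continuous_measureReal_Iic (η z)).subtype_mk _).measurable
      simp only [Kernel.prod_apply]
      rw [integral_prod_mul (fun x => f (cdfI (κ z) x)) (fun y => g (cdfI (η z) y)),
        ← integral_map (f := f) hcκ.aemeasurable hf.measurable.aestronglyMeasurable, map_cdfI,
        ← integral_map (f := g) hcη.aemeasurable hg.measurable.aestronglyMeasurable, map_cdfI]
    rw [integral_congr_ae h2]
    simp
  · refine Integrable.of_bound hmeas.aestronglyMeasurable (C * C') (ae_of_all _ fun p => ?_)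
    rw [norm_mul]
    exact mul_le_mul (hC _ (mem_univ _)) (hC' _ (mem_univ _)) (norm_nonneg _)
      ((norm_nonneg _).trans (hC 0 (mem_univ _)))

end JointLaw

/-! ### Sums that are orthogonal given a part of the sample -/

section Orthogonality

variable {α β : Type*} [MeasurableSpace α] [MeasurableSpace β] {μ : Measure α}
  [IsProbabilityMeasure μ] {c : α → β} {f : α → ℝ} {C K : ℝ}

/-- Fubini in coordinate `i`: with the other observations fixed, `f (s j)` is constant and `G` sees
`s i` only through `c (s i)`, so `horth` applies. Here `f` stands for `φ(U₁)` and `c` for the part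
of an observation used by the other estimator. -/
lemma integral_mul_mul_eq_zero_of_ne (hc : Measurable c) (hf : Measurable f)
    (hfC : ∀ a, |f a| ≤ C)
    (horth : ∀ H : β → ℝ, Measurable H → (∃ B, ∀ b, |H b| ≤ B) → ∫ a, f a * H (c a) ∂μ = 0)
    {n : ℕ} {i j : Fin n} (hij : i ≠ j) {G : (Fin n → β) → ℝ} (hG : Measurable G)
    (hGK : ∀ p, |G p| ≤ K) :
    ∫ s, f (s i) * f (s j) * G (fun m => c (s m)) ∂(Measure.pi fun _ : Fin n => μ) = 0 := by
  cases n with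
  | zero => exact i.elim0
  | succ n =>
    obtain ⟨j', rfl⟩ := Fin.exists_succAbove_eq hij.symm
    have hmp := (measurePreserving_piFinSuccAbove (fun _ : Fin (n + 1) => μ) i).symm
    have hmeas : Measurable fun s : Fin (n + 1) → α =>
        f (s i) * f (s (i.succAbove j')) * G (fun m => c (s m)) := by
      have : Measurable fun s : Fin (n + 1) → α => G (fun m => c (s m)) := hG.comp (by fun_prop)
      fun_prop
    have hint : Integrable (fun s : Fin (n + 1) → α =>
        f (s i) * f (s (i.succAbove j')) * G (fun m => c (s m)))
        (Measure.pi fun _ : Fin (n + 1) => μ) := by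
      refine Integrable.of_bound hmeas.aestronglyMeasurable (C * C * K) (ae_of_all _ fun s => ?_)
      have hC : 0 ≤ C := (abs_nonneg _).trans (hfC (s i))
      rw [norm_mul, norm_mul]
      exact mul_le_mul (mul_le_mul (hfC _) (hfC _) (norm_nonneg _) hC) (hGK _) (norm_nonneg _)
        (mul_nonneg hC hC)
    rw [← hmp.integral_comp' (g := fun s : Fin (n + 1) → α =>
      f (s i) * f (s (i.succAbove j')) * G (fun m => c (s m))), integral_prod_symm]
    swap
    · exact (hmp.integrable_comp_emb (MeasurableEquiv.measurableEmbedding _)).2 hint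
    refine integral_eq_zero_of_ae (ae_of_all _ fun t => ?_)
    have h := horth (fun b => f (t j') * G (i.insertNth (α := fun _ => β) b fun m => c (t m)))
      (measurable_const.mul (hG.comp (measurable_pi_iff.2 fun m => by
        refine Fin.succAboveCases i ?_ (fun m' => ?_) m
        · simpa using measurable_id'
        · simp)))
      ⟨C * K, fun b => by
        rw [abs_mul]
        exact mul_le_mul (hfC _) (hGK _) (abs_nonneg _) ((abs_nonneg _).trans (hfC (t j')))⟩
    refine Eq.trans (integral_congr_ae (ae_of_all _ fun a => ?_)) h
    have h2 : (fun m => c (i.insertNth (α := fun _ => α) a t m)) =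
        i.insertNth (α := fun _ => β) (c a) fun m => c (t m) := by
      funext m
      refine Fin.succAboveCases i ?_ (fun m' => ?_) m <;> simp
    simp only [MeasurableEquiv.piFinSuccAbove_symm_apply, Fin.insertNthEquiv_apply,
      Fin.insertNth_apply_same, Fin.insertNth_apply_succAbove]
    rw [h2, mul_assoc]

/-- The weights `D i` may depend on all of `c (s ·)`, so the summands need not be independent; their
orthogonality is enough to kill the off-diagonal terms. -/
lemma integral_sq_sum_le (hc : Measurable c) (hf : Measurable f) (hfC : ∀ a, |f a| ≤ C)
    (horth : ∀ H : β → ℝ, Measurable H → (∃ B, ∀ b, |H b| ≤ B) → ∫ a, f a * H (c a) ∂μ = 0)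
    {n : ℕ} {D : Fin n → (Fin n → β) → ℝ} (hD : ∀ i, Measurable (D i))
    (hDK : ∀ i p, |D i p| ≤ K) :
    ∫ s, (∑ i, f (s i) * D i (fun m => c (s m))) ^ 2 ∂(Measure.pi fun _ : Fin n => μ) ≤
      ∑ i, C ^ 2 * ∫ s, D i (fun m => c (s m)) ^ 2 ∂(Measure.pi fun _ : Fin n => μ) := by
  have hDm : ∀ i, Measurable fun s : Fin n → α => D i (fun m => c (s m)) :=
    fun i => (hD i).comp (by fun_prop)
  have hint : ∀ i j, Integrable (fun s : Fin n → α =>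
      f (s i) * f (s j) * (D i (fun m => c (s m)) * D j (fun m => c (s m))))
      (Measure.pi fun _ : Fin n => μ) := fun i j => by
    have hm : Measurable (fun s : Fin n → α =>
      f (s i) * f (s j) * (D i (fun m => c (s m)) * D j (fun m => c (s m)))) := by fun_prop
    refine Integrable.of_bound hm.aestronglyMeasurable (C * C * (K * K)) (ae_of_all _ fun s => ?_)
    have hC : 0 ≤ C := (abs_nonneg _).trans (hfC (s i))
    have hK : 0 ≤ K := (abs_nonneg _).trans (hDK i (fun m => c (s m)))
    rw [norm_mul, norm_mul, norm_mul]
    exact mul_le_mul (mul_le_mul (hfC _) (hfC _) (norm_nonneg _) hC)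
      (mul_le_mul (hDK _ _) (hDK _ _) (norm_nonneg _) hK)
      (mul_nonneg (norm_nonneg _) (norm_nonneg _)) (mul_nonneg hC hC)
  have h1 : ∀ s : Fin n → α, (∑ i, f (s i) * D i (fun m => c (s m))) ^ 2 =
      ∑ i, ∑ j, f (s i) * f (s j) * (D i (fun m => c (s m)) * D j (fun m => c (s m))) := fun s => by
    rw [sq, Finset.sum_mul_sum]
    exact Finset.sum_congr rfl fun i _ => Finset.sum_congr rfl fun j _ => by ring
  simp_rw [h1]
  rw [integral_finsetSum _ fun i _ => integrable_finsetSum _ fun j _ => hint i j]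
  refine Finset.sum_le_sum fun i _ => ?_
  rw [integral_finsetSum _ fun j _ => hint i j, Finset.sum_eq_single i, ← integral_const_mul]
  · refine integral_mono (hint i i) ?_ fun s => ?_
    · refine Integrable.const_mul ?_ _
      refine Integrable.of_bound ((hDm i).pow_const 2).aestronglyMeasurable (K ^ 2)
        (ae_of_all _ fun s => ?_)
      rw [norm_pow]
      exact pow_le_pow_left₀ (norm_nonneg _) (hDK _ _) 2
    · have h2 : f (s i) * f (s i) ≤ C ^ 2 := by
        rw [← sq, ← sq_abs]
        exact pow_le_pow_left₀ (abs_nonneg _) (hfC _) 2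
      have := mul_le_mul_of_nonneg_right h2 (sq_nonneg (D i fun m => c (s m)))
      simpa [sq] using this
  · intro j _ hj
    exact integral_mul_mul_eq_zero_of_ne hc hf hfC horth hj.symm (K := K * K)
      (G := fun p => D i p * D j p) ((hD i).mul (hD j)) fun p => by
        rw [abs_mul]
        exact mul_le_mul (hDK _ _) (hDK _ _) (abs_nonneg _)
          ((abs_nonneg _).trans (hDK i p))
  · simp

/-- Chebyshev's inequality: weights that are bounded, and small in probability uniformly in `i`,
have uniformly small second moments, so the sum has second moment `o(n)`. -/
lemma tendsto_measure_inv_sqrt_mul_sum (hc : Measurable c) (hf : Measurable f)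
    (hfC : ∀ a, |f a| ≤ C)
    (horth : ∀ H : β → ℝ, Measurable H → (∃ B, ∀ b, |H b| ≤ B) → ∫ a, f a * H (c a) ∂μ = 0)
    {D : (n : ℕ) → Fin n → (Fin n → β) → ℝ} (hD : ∀ n i, Measurable (D n i))
    (hDK : ∀ n i p, |D n i p| ≤ K)
    (hsmall : ∀ η : ℝ, 0 < η → ∀ ε : ℝ, 0 < ε → ∀ᶠ n in atTop, ∀ i : Fin n,
      (Measure.pi fun _ : Fin n => μ) {s | η < |D n i (fun m => c (s m))|} ≤ ENNReal.ofReal ε)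
    {δ : ℝ} (hδ : 0 < δ) :
    Tendsto (fun n : ℕ => (Measure.pi fun _ : Fin n => μ)
      {s | δ ≤ |(√(n : ℝ))⁻¹ * ∑ i, f (s i) * D n i (fun m => c (s m))|}) atTop (𝓝 0) := by
  rw [ENNReal.tendsto_nhds_zero]
  intro ε hε
  wlog htop : ε ≠ ∞ generalizing ε
  · rw [not_not.1 htop]
    exact Eventually.of_forall fun n => le_top
  have hε' : 0 < ε.toReal := ENNReal.toReal_pos hε.ne' htop
  set B : ℝ := C ^ 2 + 1 with hB
  set A : ℝ := K ^ 2 + 1 with hA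
  have hB0 : 0 < B := by positivity
  have hA0 : 0 < A := by positivity
  -- Chosen so that `B * (2 * r) = δ ^ 2 * ε`, which is what Chebyshev's bound needs below; the `+
  -- 1` in `A` and `B` makes the divisions legitimate.
  set r : ℝ := ε.toReal * δ ^ 2 / (2 * B) with hr
  have hr0 : 0 < r := by positivity
  filter_upwards [hsmall (√r) (Real.sqrt_pos.2 hr0) (r / A) (by positivity), eventually_ge_atTop 1]
    with n hn hn1
  have hn0 : (0 : ℝ) < n := by exact_mod_cast hn1
  set ν : Measure (Fin n → α) := Measure.pi fun _ : Fin n => μ with hν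
  have hDm : ∀ i, Measurable fun s : Fin n → α => D n i (fun m => c (s m)) :=
    fun i => (hD n i).comp (by fun_prop)
  have hD2 : ∀ i, ∫ s, D n i (fun m => c (s m)) ^ 2 ∂ν ≤ 2 * r := fun i => by
    have hset : MeasurableSet {s : Fin n → α | √r < |D n i (fun m => c (s m))|} :=
      measurableSet_lt measurable_const (hDm i).abs
    -- Truncation at `√r`: the part below contributes at most `r`, and the part above at most `A`
    -- times a probability `≤ r / A`.
    have hle : ∀ s : Fin n → α, D n i (fun m => c (s m)) ^ 2 ≤ r +
        {s : Fin n → α | √r < |D n i (fun m => c (s m))|}.indicator (fun _ => A) s := fun s => by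
      by_cases h : √r < |D n i (fun m => c (s m))|
      · rw [indicator_of_mem (show s ∈ {s : Fin n → α | √r < |D n i (fun m => c (s m))|} from h),
          ← sq_abs]
        have := pow_le_pow_left₀ (abs_nonneg _) (hDK n i (fun m => c (s m))) 2
        linarith
      · rw [indicator_of_notMem
          (show s ∉ {s : Fin n → α | √r < |D n i (fun m => c (s m))|} from h), ← sq_abs, add_zero]
        have := pow_le_pow_left₀ (abs_nonneg _) (not_lt.1 h) 2
        rwa [Real.sq_sqrt hr0.le] at this
    refine (integral_mono_of_nonneg (ae_of_all _ fun s => sq_nonneg _)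
      ((integrable_const r).add ((integrable_const A).indicator hset)) (ae_of_all _ hle)).trans ?_
    rw [integral_add' (integrable_const r) ((integrable_const A).indicator hset),
      integral_indicator hset]
    have hm : ν.real {s : Fin n → α | √r < |D n i (fun m => c (s m))|} ≤ r / A :=
      ENNReal.toReal_le_of_le_ofReal (by positivity) (hn i)
    have : ν.real {s : Fin n → α | √r < |D n i (fun m => c (s m))|} * A ≤ r := by
      rwa [le_div_iff₀ hA0] at hm
    simp
    linarith
  have hS := integral_sq_sum_le hc hf hfC horth (hD n) (hDK n)
  have hS2 : ∫ s, (∑ i, f (s i) * D n i (fun m => c (s m))) ^ 2 ∂ν ≤ n * (C ^ 2 * (2 * r)) := by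
    refine hS.trans ((Finset.sum_le_sum fun i _ =>
      mul_le_mul_of_nonneg_left (hD2 i) (sq_nonneg C)).trans ?_)
    simp
  have hmS : Measurable fun s : Fin n → α => ∑ i, f (s i) * D n i (fun m => c (s m)) := by
    fun_prop
  have hintS : Integrable
      (fun s : Fin n → α => (∑ i, f (s i) * D n i (fun m => c (s m))) ^ 2) ν := by
    refine Integrable.of_bound (hmS.pow_const 2).aestronglyMeasurable
      ((∑ _i : Fin n, C * K) ^ 2) (ae_of_all _ fun s => ?_)
    rw [norm_pow]
    refine pow_le_pow_left₀ (norm_nonneg _) ((norm_sum_le _ _).trans ?_) 2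
    refine Finset.sum_le_sum fun i _ => ?_
    rw [norm_mul]
    exact mul_le_mul (hfC _) (hDK _ _ _) (norm_nonneg _) ((abs_nonneg _).trans (hfC (s i)))
  have hcheb := mul_meas_ge_le_integral_of_nonneg (ae_of_all _ fun s => sq_nonneg _) hintS
    (n * δ ^ 2)
  have hsub : {s : Fin n → α | δ ≤ |(√(n : ℝ))⁻¹ * ∑ i, f (s i) * D n i (fun m => c (s m))|} ⊆
      {s | n * δ ^ 2 ≤ (∑ i, f (s i) * D n i (fun m => c (s m))) ^ 2} := fun s hs => by
    have h1 := pow_le_pow_left₀ hδ.le hs 2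
    rw [sq_abs, mul_pow, inv_pow, Real.sq_sqrt hn0.le, ← div_eq_inv_mul, le_div_iff₀ hn0] at h1
    simpa [mul_comm] using h1
  refine (measure_mono hsub).trans ?_
  have h3 : ν.real {s | n * δ ^ 2 ≤ (∑ i, f (s i) * D n i (fun m => c (s m))) ^ 2} ≤ ε.toReal := by
    have h4 : n * δ ^ 2 * ν.real {s | n * δ ^ 2 ≤
        (∑ i, f (s i) * D n i (fun m => c (s m))) ^ 2} ≤ n * δ ^ 2 * ε.toReal := by
      refine (hcheb.trans hS2).trans ?_
      have h5 : C ^ 2 * (2 * r) ≤ B * (2 * r) :=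
        mul_le_mul_of_nonneg_right (by linarith) (by positivity)
      have h6 : B * (2 * r) = δ ^ 2 * ε.toReal := by
        rw [hr]
        field_simp
      rw [mul_assoc]
      exact mul_le_mul_of_nonneg_left (h5.trans h6.le) hn0.le
    exact le_of_mul_le_mul_left h4 (by positivity)
  rw [measureReal_def] at h3
  exact (ENNReal.toReal_le_toReal (measure_ne_top _ _) htop).1 h3

end Orthogonality

/-! ### The estimation error of the generalized correlation -/

section EstimationError

variable {d q : ℕ} {φ : Fin q → I → ℝ} {P : ProbabilityMeasure (Obs d)}

instance (n : ℕ) : IsProbabilityMeasure (sampleLaw P n) := by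
  unfold sampleLaw
  infer_instance

/-- The error made by `φ_k` when the conditional probability integral transform is estimated. -/
noncomputable def transformError (φ : Fin q → I → ℝ) (E : CondCDFEstimator d)
    (κ : Kernel (Cube d) I) [IsMarkovKernel κ] (k : Fin q) (n : ℕ) (i : Fin n)
    (p : Fin n → I × Cube d) : ℝ :=
  φ k (E.est n p (p i).1 (p i).2) - φ k (cdfI (κ (p i).2) (p i).1)

variable {E E' : CondCDFEstimator d} {κ η : Kernel (Cube d) I} [IsMarkovKernel κ]
  [IsMarkovKernel η] {V W : Obs d → I} {g h : ℕ → ℝ} {L : ℝ}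

lemma measurable_apply_est (hφ : IsCorrelationMap φ) (E : CondCDFEstimator d) (k : Fin q) (n : ℕ)
    (i : Fin n) :
    Measurable fun p : Fin n → I × Cube d => φ k (E.est n p (p i).1 (p i).2) :=
  (hφ.continuous k).measurable.comp ((E.measurable_est n).comp
    (show Measurable fun p : Fin n → I × Cube d => (p, (p i).1, (p i).2) by fun_prop))

lemma measurable_apply_cdfI (hφ : IsCorrelationMap φ) (κ : Kernel (Cube d) I) [IsMarkovKernel κ]
    (hV : Measurable V) (k : Fin q) :
    Measurable fun w : Obs d => φ k (cdfI (κ (coordZ d w)) (V w)) :=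
  (hφ.continuous k).measurable.comp ((measurable_cdfI κ).comp
    (hV.prodMk (measurable_coordZ d)))

lemma measurable_transformError (hφ : IsCorrelationMap φ) (E : CondCDFEstimator d)
    (κ : Kernel (Cube d) I) [IsMarkovKernel κ] (k : Fin q) (n : ℕ) (i : Fin n) :
    Measurable (transformError φ E κ k n i) :=
  (measurable_apply_est hφ E k n i).sub ((hφ.continuous k).measurable.comp
    ((measurable_cdfI κ).comp (show Measurable fun p : Fin n → I × Cube d =>
      ((p i).1, (p i).2) by fun_prop)))

lemma abs_transformError_le {C : ℝ} (hC : ∀ k u, |φ k u| ≤ C) (k : Fin q) (n : ℕ) (i : Fin n)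
    (p : Fin n → I × Cube d) : |transformError φ E κ k n i p| ≤ 2 * C := by
  refine (abs_sub _ _).trans ?_
  linarith [hC k (E.est n p (p i).1 (p i).2), hC k (cdfI (κ (p i).2) (p i).1)]

/-- One event, that the sup norm exceeds `M |g n|`, covers the failures for all `k` and `i` at once,
up to the null set of samples for which some `κ (Z_i)` has an atom. -/
lemma exists_measure_transformError_le (hq : 1 ≤ q) (hφ : IsCorrelationMap φ) (hL0 : 0 ≤ L)
    (hL : ∀ k u v, |φ k u - φ k v| ≤ L * |(u : ℝ) - v|)
    (hatom : ∀ᵐ z ∂(P : Measure (Obs d)).map (coordZ d), NullSingletonClass (κ z))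
    (hcons : IsBigOInProb P (fun n s => supNormInner φ κ fun t z =>
      cdfOf κ t z - (E.est n (fun i => (V (s i), coordZ d (s i))) t z : ℝ)) g)
    {ε : ℝ} (hε : 0 < ε) :
    ∃ M : ℝ, 0 < M ∧ ∀ n : ℕ, 1 ≤ n → sampleLaw P n {s | ∃ k i, L * (M * |g n|) <
      |transformError φ E κ k n i fun m => (V (s m), coordZ d (s m))|} ≤ ENNReal.ofReal ε := by
  obtain ⟨M, hM, hMn⟩ := hcons ε hε
  refine ⟨M, hM, fun n hn => le_trans (measure_mono_ae ?_) (hMn n hn)⟩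
  have hz : ∀ᵐ s ∂sampleLaw P n, ∀ i, NullSingletonClass (κ (coordZ d (s i))) := by
    refine ae_all_iff.2 fun i => ?_
    have h1 := ae_of_ae_map (measurable_coordZ d).aemeasurable hatom
    exact (measurePreserving_eval (fun _ : Fin n => (P : Measure (Obs d)))
      i).quasiMeasurePreserving.ae h1
  filter_upwards [hz] with s hs
  intro hlt
  obtain ⟨k, i, hki⟩ := hlt
  by_contra hle
  have := hs i
  exact absurd (abs_apply_sub_apply_cdfI_le κ hq hφ hL0 hL k
    (fun z => E.monotone_est n _ z) (mul_nonneg hM.le (abs_nonneg _)) (not_lt.1 hle)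
    (V (s i)) (coordZ d (s i))) (not_le.2 hki)

/-- No rate is needed, thanks to cancellation: the oracle factor is orthogonal to bounded functions
of `(W, Z)`, and the error depends on the sample only through these. Keeping `V` and `W` abstract
covers both mixed terms. -/
lemma tendsto_measure_oracle_mul_error (hq : 1 ≤ q) (hφ : IsCorrelationMap φ)
    (hV : Measurable V) (hW : Measurable W)
    (hlaw : (P : Measure (Obs d)).map (fun w => (coordZ d w, V w, W w)) =
      (P : Measure (Obs d)).map (coordZ d) ⊗ₘ (κ ×ₖ η))
    (hκa : ∀ᵐ z ∂(P : Measure (Obs d)).map (coordZ d), NullSingletonClass (κ z))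
    (hηa : ∀ᵐ z ∂(P : Measure (Obs d)).map (coordZ d), NullSingletonClass (η z))
    (hh : Tendsto h atTop (𝓝 0))
    (hcons : IsBigOInProb P (fun n s => supNormInner φ η fun t z =>
      cdfOf η t z - (E.est n (fun i => (W (s i), coordZ d (s i))) t z : ℝ)) h)
    (k l : Fin q) {δ : ℝ} (hδ : 0 < δ) :
    Tendsto (fun n : ℕ => sampleLaw P n {s | δ ≤ |(√(n : ℝ))⁻¹ * ∑ i,
      φ k (cdfI (κ (coordZ d (s i))) (V (s i))) *
        transformError φ E η l n i fun m => (W (s m), coordZ d (s m))|}) atTop (𝓝 0) := by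
  obtain ⟨L, hL0, hL⟩ := hφ.exists_lipschitz
  obtain ⟨C, -, hC⟩ := hφ.exists_bound
  refine tendsto_measure_inv_sqrt_mul_sum (μ := (P : Measure (Obs d)))
    (c := fun w => (W w, coordZ d w)) (f := fun w => φ k (cdfI (κ (coordZ d w)) (V w)))
    (D := fun n i => transformError φ E η l n i)
    (hW.prodMk (measurable_coordZ d)) (measurable_apply_cdfI hφ κ hV k) (fun w => hC k _)
    (fun H hH ⟨B, hB⟩ => integral_apply_cdfI_mul_eq_zero hV hW hlaw hκa (hφ.continuous k)
      (hφ.integral_eq_zero k) hH hB)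
    (fun n i => measurable_transformError hφ E η l n i)
    (fun n i p => abs_transformError_le hC l n i p) (fun r hr ε hε => ?_) hδ
  obtain ⟨M, hM, hMn⟩ := exists_measure_transformError_le hq hφ hL0.le hL hηa hcons hε
  have ht : Tendsto (fun n => L * (M * |h n|)) atTop (𝓝 0) := by
    simpa using (hh.abs.const_mul M).const_mul L
  filter_upwards [ht.eventually_lt_const hr, eventually_ge_atTop 1] with n hn hn1 i
  refine (measure_mono fun s hs => ?_).trans (hMn n hn1)
  exact ⟨l, i, hn.trans hs⟩

/-- There is no cancellation here: each of the `n` products is bounded by the product of the two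
rates, and this is where `√n g h → 0` enters. -/
lemma tendsto_measure_error_mul_error (hq : 1 ≤ q) (hφ : IsCorrelationMap φ)
    (hκa : ∀ᵐ z ∂(P : Measure (Obs d)).map (coordZ d), NullSingletonClass (κ z))
    (hηa : ∀ᵐ z ∂(P : Measure (Obs d)).map (coordZ d), NullSingletonClass (η z))
    (hgh : Tendsto (fun n : ℕ => √(n : ℝ) * g n * h n) atTop (𝓝 0))
    (hconsV : IsBigOInProb P (fun n s => supNormInner φ κ fun t z =>
      cdfOf κ t z - (E.est n (fun i => (V (s i), coordZ d (s i))) t z : ℝ)) g)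
    (hconsW : IsBigOInProb P (fun n s => supNormInner φ η fun t z =>
      cdfOf η t z - (E'.est n (fun i => (W (s i), coordZ d (s i))) t z : ℝ)) h)
    (k l : Fin q) {δ : ℝ} (hδ : 0 < δ) :
    Tendsto (fun n : ℕ => sampleLaw P n {s | δ ≤ |(√(n : ℝ))⁻¹ * ∑ i,
      (transformError φ E κ k n i fun m => (V (s m), coordZ d (s m))) *
        transformError φ E' η l n i fun m => (W (s m), coordZ d (s m))|}) atTop (𝓝 0) := by
  obtain ⟨L, hL0, hL⟩ := hφ.exists_lipschitz
  rw [ENNReal.tendsto_nhds_zero]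
  intro ε hε
  wlog htop : ε ≠ ∞ generalizing ε
  · rw [not_not.1 htop]
    exact Eventually.of_forall fun n => le_top
  have hε' : 0 < ε.toReal / 2 := half_pos (ENNReal.toReal_pos hε.ne' htop)
  obtain ⟨M, hM, hMn⟩ := exists_measure_transformError_le hq hφ hL0.le hL hκa hconsV hε'
  obtain ⟨M', hM', hMn'⟩ := exists_measure_transformError_le hq hφ hL0.le hL hηa hconsW hε'
  have ht : Tendsto (fun n : ℕ => L * M * (L * M') * |√(n : ℝ) * g n * h n|) atTop (𝓝 0) := by
    simpa using hgh.abs.const_mul (L * M * (L * M'))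
  filter_upwards [ht.eventually_lt_const hδ, eventually_ge_atTop 1] with n hn hn1
  have hsqrt : 0 < √(n : ℝ) := Real.sqrt_pos.2 (by exact_mod_cast hn1)
  have hadd : ENNReal.ofReal (ε.toReal / 2) + ENNReal.ofReal (ε.toReal / 2) = ε := by
    rw [← ENNReal.ofReal_add hε'.le hε'.le, add_halves, ENNReal.ofReal_toReal htop]
  refine (measure_mono fun s hs => ?_).trans ((measure_union_le _ _).trans
    ((add_le_add (hMn n hn1) (hMn' n hn1)).trans hadd.le))
  by_contra hcon
  simp only [mem_union, mem_ofPred_eq, not_or, not_exists, not_lt] at hcon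
  obtain ⟨hA, hB⟩ := hcon
  refine absurd hn (not_lt.2 (le_trans hs ?_))
  rw [abs_mul, abs_of_pos (inv_pos.2 hsqrt)]
  have hsum : |∑ i, (transformError φ E κ k n i fun m => (V (s m), coordZ d (s m))) *
        transformError φ E' η l n i fun m => (W (s m), coordZ d (s m))| ≤
      n * (L * (M * |g n|) * (L * (M' * |h n|))) := by
    refine (Finset.abs_sum_le_sum_abs _ _).trans ((Finset.sum_le_sum fun i _ => ?_).trans_eq
      (b := ∑ _i : Fin n, L * (M * |g n|) * (L * (M' * |h n|))) (by simp))
    rw [abs_mul]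
    exact mul_le_mul (hA k i) (hB l i) (abs_nonneg _) (by positivity)
  refine (mul_le_mul_of_nonneg_left hsum (inv_nonneg.2 hsqrt.le)).trans_eq ?_
  have hn2 : (n : ℝ) = √(n : ℝ) * √(n : ℝ) := (Real.mul_self_sqrt (Nat.cast_nonneg n)).symm
  rw [abs_mul, abs_mul, abs_of_pos hsqrt]
  nth_rewrite 2 [hn2]
  field_simp

/-- The generalized correlation that is computed from the true conditional distribution
functions. -/
noncomputable def rhoOracle (φ : Fin q → I → ℝ) (κ η : Kernel (Cube d) I) [IsMarkovKernel κ]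
    [IsMarkovKernel η] (n : ℕ) (s : Fin n → Obs d) : Matrix (Fin q) (Fin q) ℝ :=
  Matrix.of fun k l => (n : ℝ)⁻¹ * ∑ i, φ k (cdfI (κ (coordZ d (s i))) (coordX d (s i))) *
    φ l (cdfI (η (coordZ d (s i))) (coordY d (s i)))

lemma sqrt_mul_rhoHat_sub_rhoOracle (EX EY : CondCDFEstimator d) {n : ℕ} (hn : 1 ≤ n)
    (s : Fin n → Obs d) (k l : Fin q) :
    √(n : ℝ) * (rhoHat φ EX EY n s k l - rhoOracle φ κ η n s k l) =
      (√(n : ℝ))⁻¹ * ∑ i, (transformError φ EX κ k n i fun m => (coordX d (s m), coordZ d (s m))) *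
        (transformError φ EY η l n i fun m => (coordY d (s m), coordZ d (s m))) +
      (√(n : ℝ))⁻¹ * ∑ i, φ k (cdfI (κ (coordZ d (s i))) (coordX d (s i))) *
        (transformError φ EY η l n i fun m => (coordY d (s m), coordZ d (s m))) +
      (√(n : ℝ))⁻¹ * ∑ i, φ l (cdfI (η (coordZ d (s i))) (coordY d (s i))) *
        (transformError φ EX κ k n i fun m => (coordX d (s m), coordZ d (s m))) := by
  have hsqrt : 0 < √(n : ℝ) := Real.sqrt_pos.2 (by exact_mod_cast hn)
  have h1 : √(n : ℝ) * (n : ℝ)⁻¹ = (√(n : ℝ))⁻¹ := by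
    nth_rewrite 2 [← Real.mul_self_sqrt (Nat.cast_nonneg n)]
    field_simp
  simp only [rhoHat, rhoOracle, Matrix.of_apply]
  rw [← mul_sub, ← Finset.sum_sub_distrib, ← mul_assoc, h1, ← mul_add, ← mul_add,
    ← Finset.sum_add_distrib, ← Finset.sum_add_distrib]
  congr 1
  refine Finset.sum_congr rfl fun i _ => ?_
  simp only [transformError, CondCDFEstimator.estX, CondCDFEstimator.estY]
  ring

lemma tendsto_measure_sqrt_mul_rhoHat_sub_rhoOracle (hq : 1 ≤ q) (hφ : IsCorrelationMap φ)
    {EX EY : CondCDFEstimator d} (hP : P ∈ condIndepLaws d)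
    (hκ : IsCondLaw P (coordX d) κ) (hη : IsCondLaw P (coordY d) η)
    (hcons : IsConsistentWithRates φ EX EY P κ η g h)
    (hgh : Tendsto (fun n : ℕ => √(n : ℝ) * g n * h n) atTop (𝓝 0))
    (k l : Fin q) {δ : ℝ} (hδ : 0 < δ) :
    Tendsto (fun n : ℕ => sampleLaw P n {s | δ ≤
      |√(n : ℝ) * (rhoHat φ EX EY n s k l - rhoOracle φ κ η n s k l)|}) atTop (𝓝 0) := by
  have hX : Measurable (coordX d) := measurable_fst
  have hY : Measurable (coordY d) := measurable_fst.comp measurable_snd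
  have hκa := ae_nullSingletonClass hκ hX (map_coordX_absolutelyContinuous hP.1)
  have hηa := ae_nullSingletonClass hη hY (map_coordY_absolutelyContinuous hP.1)
  have hlaw := map_eq_compProd_prod hX hY hκ hη hP.2
  have hlaw' := map_eq_compProd_prod hY hX hη hκ hP.2.symm
  have hδ3 : 0 < δ / 3 := by positivity
  have h1 := tendsto_measure_error_mul_error hq hφ hκa hηa hgh hcons.inner_left hcons.inner_right
    k l hδ3
  have h2 := tendsto_measure_oracle_mul_error hq hφ hX hY hlaw hκa hηa hcons.tendsto_right
    hcons.inner_right k l hδ3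
  -- The roles of `X` and `Y` are exchanged, by symmetry of conditional independence.
  have h3 := tendsto_measure_oracle_mul_error hq hφ hY hX hlaw' hηa hκa hcons.tendsto_left
    hcons.inner_left l k hδ3
  have hsum := (h1.add h2).add h3
  simp only [add_zero] at hsum
  refine tendsto_of_tendsto_of_tendsto_of_le_of_le' tendsto_const_nhds hsum
    (Eventually.of_forall fun n => zero_le) ?_
  filter_upwards [eventually_ge_atTop 1] with n hn
  refine (measure_mono fun s hs => ?_).trans ((measure_union_le _ _).trans
    (add_le_add_left (measure_union_le _ _) _))
  by_contra hcon
  simp only [mem_union, mem_ofPred_eq, not_or, not_le] at hcon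
  rw [mem_ofPred_eq, sqrt_mul_rhoHat_sub_rhoOracle EX EY hn] at hs
  have := hs.trans ((abs_add_le _ _).trans (add_le_add_left (abs_add_le _ _) _))
  linarith [hcon.1.1, hcon.1.2, hcon.2]

end EstimationError

/-! ### The central limit theorem in several dimensions -/

section CentralLimit

variable {Ω E : Type*} [MeasurableSpace Ω] {μ : Measure Ω}
  [NormedAddCommGroup E] [InnerProductSpace ℝ E] [MeasurableSpace E] [BorelSpace E]

/-- The Cramér–Wold device, which reduces the vector limit theorem to the scalar one. -/
lemma charFun_map_smul_eq_charFun_map_inner {Y : Ω → E} (hY : AEMeasurable Y μ) (u : E) (r : ℝ) :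
    charFun (μ.map Y) (r • u) = charFun (μ.map fun ω => inner ℝ (Y ω) u) r := by
  have hu : Continuous fun x : E => inner ℝ x u := by fun_prop
  have hm : AEMeasurable (fun ω => inner ℝ (Y ω) u) μ := hu.measurable.comp_aemeasurable hY
  have h1 : AEStronglyMeasurable (fun x : ℝ => Complex.exp (r * x * Complex.I))
      (μ.map fun ω => inner ℝ (Y ω) u) := by fun_prop
  have h2 : Continuous fun x : E => Complex.exp ((inner ℝ x (r • u) : ℝ) * Complex.I) := by
    fun_prop
  rw [charFun_apply, charFun_apply_real, integral_map hY h2.measurable.aestronglyMeasurable,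
    integral_map hm h1]
  simp [inner_smul_right]

variable [IsProbabilityMeasure μ] [FiniteDimensional ℝ E]

/-- The central limit theorem for independent copies of a standardized random vector. -/
theorem tendstoInDistribution_inv_sqrt_smul_sum_stdGaussian {X : ℕ → Ω → E}
    (h0 : ∀ t : E, ∫ ω, inner ℝ (X 0 ω) t ∂μ = 0)
    (h1 : ∀ t : E, ∫ ω, inner ℝ (X 0 ω) t ^ 2 ∂μ = ‖t‖ ^ 2)
    (hindep : iIndepFun X μ) (hident : ∀ i, IdentDistrib (X i) (X 0) μ μ) :
    TendstoInDistribution (fun (n : ℕ) ω => (√(n : ℝ))⁻¹ • ∑ k ∈ Finset.range n, X k ω) atTop id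
      (fun _ => μ) (stdGaussian E) where
  forall_aemeasurable n :=
    (Finset.aemeasurable_fun_sum _ fun i _ => (hident i).aemeasurable_fst).const_smul _
  tendsto := by
    refine ProbabilityMeasure.tendsto_iff_tendsto_charFun.2 fun t => ?_
    have hmeas : ∀ n : ℕ,
        AEMeasurable (fun ω => (√(n : ℝ))⁻¹ • ∑ k ∈ Finset.range n, X k ω) μ := fun n =>
      (Finset.aemeasurable_fun_sum _ fun i _ => (hident i).aemeasurable_fst).const_smul _
    rcases eq_or_ne t 0 with rfl | ht
    · have : ∀ n : ℕ, IsProbabilityMeasure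
          (μ.map fun ω => (√(n : ℝ))⁻¹ • ∑ k ∈ Finset.range n, X k ω) :=
        fun n => Measure.isProbabilityMeasure_map (hmeas n)
      simp [charFun_zero]
    -- The projection on the unit vector `u` has variance `1`, so the scalar theorem evaluated at
    -- `‖t‖` gives the limit `exp (-‖t‖ ^ 2 / 2)`.
    · set u : E := ‖t‖⁻¹ • t with hu
      have ht0 : ‖t‖ ≠ 0 := norm_ne_zero_iff.2 ht
      have hu1 : ‖u‖ = 1 := by simp [hu, norm_smul, ht0]
      have htu : ‖t‖ • u = t := by simp [hu, smul_smul, ht0]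
      have hcont : Continuous fun x : E => inner ℝ x u := by fun_prop
      have hclt := tendstoInDistribution_inv_sqrt_mul_sum (P := μ) (P' := gaussianReal 0 1)
        (Y := id) (X := fun i ω => inner ℝ (X i ω) u) HasLaw.id (h0 u)
        (by simpa [hu1] using h1 u) (hindep.comp (fun _ x => inner ℝ x u) fun _ => hcont.measurable)
        (fun i => (hident i).comp hcont.measurable)
      have hchar := ProbabilityMeasure.tendsto_iff_tendsto_charFun.1 hclt.tendsto ‖t‖
      simp only [ProbabilityMeasure.coe_mk, Measure.map_id, charFun_gaussianReal] at hchar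
      simp only [ProbabilityMeasure.coe_mk, Measure.map_id, charFun_stdGaussian]
      have hlim : Complex.exp (-(‖t‖ : ℂ) ^ 2 / 2) =
          Complex.exp (‖t‖ * (0 : ℝ) * Complex.I - ((1 : NNReal) : ℝ) * ‖t‖ ^ 2 / 2) := by
        congr 1
        push_cast
        ring
      rw [hlim]
      refine hchar.congr fun n => ?_
      conv_rhs => rw [← htu]
      rw [charFun_map_smul_eq_charFun_map_inner (hmeas n)]
      simp [inner_smul_left, sum_inner]

end CentralLimit

/-! ### The chi-squared distribution -/

section ChiSquared

lemma map_norm_sq_stdGaussian {ι : Type*} [Fintype ι] {k : ℕ} (e : ι ≃ Fin k) :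
    (stdGaussian (EuclideanSpace ℝ ι)).map (fun x => ‖x‖ ^ 2) = chiSquared k := by
  rw [← stdGaussian_map (LinearIsometryEquiv.piLpCongrLeft 2 ℝ ℝ e.symm), ← map_pi_eq_stdGaussian,
    Measure.map_map (by fun_prop) (by fun_prop), Measure.map_map (by fun_prop) (by fun_prop),
    chiSquared]
  congr 1
  funext x
  simpa [EuclideanSpace.real_norm_sq_eq] using e.sum_comp fun i => x i ^ 2

instance (k : ℕ) : IsProbabilityMeasure (chiSquared k) := by
  unfold chiSquared
  exact Measure.isProbabilityMeasure_map (Measurable.aemeasurable (by fun_prop))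

/-- Given the other coordinates, the sum of squares hits `c` for at most two values of the first
one, a Gaussian null set. For `k = 0` the law is a point mass. -/
lemma nullSingletonClass_chiSquared {k : ℕ} (hk : 1 ≤ k) : NullSingletonClass (chiSquared k) := by
  obtain ⟨m, rfl⟩ := Nat.exists_eq_add_of_le' hk
  refine ⟨fun c => ?_⟩
  have hm : Measurable fun x : Fin (m + 1) → ℝ => ∑ i, x i ^ 2 := by fun_prop
  have hmp := (measurePreserving_piFinSuccAbove (fun _ : Fin (m + 1) => gaussianReal 0 1) 0).symm
  rw [chiSquared, Measure.map_apply hm (measurableSet_singleton c), ← hmp.measure_preimage_equiv,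
    Measure.prod_apply_symm]
  · refine (lintegral_congr fun y => ?_).trans lintegral_zero
    have : NullSingletonClass (gaussianReal 0 1) := nullSingletonClass_gaussianReal one_ne_zero
    refine Set.Finite.measure_zero (Set.Finite.subset
      (Set.toFinite {√(c - ∑ j, y j ^ 2), -√(c - ∑ j, y j ^ 2)}) fun x hx => ?_) _
    have h1 : x ^ 2 = c - ∑ j, y j ^ 2 := by
      have h2 : x ^ 2 + ∑ j, y j ^ 2 = c := by
        simpa [Fin.sum_univ_succ, Fin.insertNthEquiv] using hx
      linarith
    rw [← h1, Real.sqrt_sq_eq_abs]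
    rcases abs_choice x with h | h <;> simp [h]
  · exact (MeasurableEquiv.measurable _) (hm (measurableSet_singleton c))

lemma measureReal_Iic_realQuantile (μ : Measure ℝ) [IsProbabilityMeasure μ]
    [NullSingletonClass μ] {p : ℝ} (hp : p ∈ Ioo (0 : ℝ) 1) :
    μ.real (Iic (realQuantile μ p)) = p := by
  have hc := continuous_measureReal_Iic μ
  have hmono : Monotone fun t => μ.real (Iic t) :=
    fun _ _ h => measureReal_mono (Iic_subset_Iic.2 h)
  obtain ⟨a, ha⟩ : ∃ a, μ.real (Iic a) < p := by
    obtain ⟨a, ha⟩ := ((tendsto_cdf_atBot μ).eventually_lt_const hp.1).exists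
    exact ⟨a, by rwa [cdf_eq_real] at ha⟩
  obtain ⟨b, hb⟩ : ∃ b, p < μ.real (Iic b) := by
    obtain ⟨b, hb⟩ := ((tendsto_cdf_atTop μ).eventually_const_lt hp.2).exists
    exact ⟨b, by rwa [cdf_eq_real] at hb⟩
  obtain ⟨t, ht⟩ := mem_range_of_exists_le_of_exists_ge hc ⟨a, ha.le⟩ ⟨b, hb.le⟩
  -- Without a lower bound the real `sInf` would take its default value `0`.
  have hbdd : BddBelow {t : ℝ | p ≤ μ.real (Iic t)} :=
    ⟨a, fun s hs => (hmono.reflect_lt (ha.trans_le hs)).le⟩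
  refine le_antisymm ?_ ?_
  · exact (hmono (csInf_le hbdd ht.ge)).trans ht.le
  · exact (isClosed_le continuous_const hc).csInf_mem ⟨t, ht.ge⟩ hbdd

end ChiSquared

/-! ### Asymptotic distribution of the test statistic -/

section Asymptotics

variable {d q : ℕ} {φ : Fin q → I → ℝ} {P : ProbabilityMeasure (Obs d)}
  {κ η : Kernel (Cube d) I} [IsMarkovKernel κ] [IsMarkovKernel η] {EX EY : CondCDFEstimator d}
  {g h : ℕ → ℝ}

/-- The law of an infinite i.i.d. sample. -/
noncomputable def sequenceLaw (P : ProbabilityMeasure (Obs d)) : Measure (ℕ → Obs d) :=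
  Measure.infinitePi fun _ => (P : Measure (Obs d))

instance : IsProbabilityMeasure (sequenceLaw P) := by
  unfold sequenceLaw
  infer_instance

/-- The first `n` observations of an infinite sample. -/
def truncate (n : ℕ) (ω : ℕ → Obs d) : Fin n → Obs d := fun i => ω i

lemma measurable_truncate (n : ℕ) : Measurable (truncate (d := d) n) := by
  unfold truncate
  fun_prop

/-- Samples of all sizes are placed on one probability space, as convergence in measure requires. -/
lemma map_truncate_sequenceLaw (P : ProbabilityMeasure (Obs d)) (n : ℕ) :
    (sequenceLaw P).map (truncate n) = sampleLaw P n := by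
  have h := Measure.map_infinitePi_infinitePi_of_inj (P := fun _ : ℕ => (P : Measure (Obs d)))
    (f := fun i : Fin n => (i : ℕ)) Fin.val_injective
  exact h.trans (Measure.infinitePi_eq_pi _)

/-- The entries of `Σ^{-1/2} M Σ^{-1/2}` as a vector. -/
noncomputable def whitenVec (φ : Fin q → I → ℝ) :
    Matrix (Fin q) (Fin q) ℝ →ₗ[ℝ] EuclideanSpace ℝ (Fin q × Fin q) where
  toFun M := WithLp.toLp 2 fun p => (sigmaInvSqrt φ * M * sigmaInvSqrt φ) p.1 p.2
  map_add' M N := by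
    ext p
    simp [Matrix.mul_add, Matrix.add_mul]
  map_smul' r M := by
    ext p
    simp

lemma norm_sq_whitenVec (A : Matrix (Fin q) (Fin q) ℝ) :
    ‖whitenVec φ A‖ ^ 2 = frobeniusSq (sigmaInvSqrt φ * A * sigmaInvSqrt φ) := by
  rw [EuclideanSpace.real_norm_sq_eq, Fintype.sum_prod_type]
  rfl

/-- The contribution of one observation to the whitened oracle correlation. -/
noncomputable def score (φ : Fin q → I → ℝ) (κ η : Kernel (Cube d) I) [IsMarkovKernel κ]
    [IsMarkovKernel η] (w : Obs d) : EuclideanSpace ℝ (Fin q × Fin q) :=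
  WithLp.toLp 2 fun p => whitened φ p.1 (cdfI (κ (coordZ d w)) (coordX d w)) *
    whitened φ p.2 (cdfI (η (coordZ d w)) (coordY d w))

/-- Since `S = Σ^{-1/2}` is symmetric, `S (φ(u) φ(v)ᵀ) S = (S φ(u)) (S φ(v))ᵀ`. -/
lemma whitenVec_outer (u v : I) :
    whitenVec φ (Matrix.of fun k l => φ k u * φ l v) =
      WithLp.toLp 2 fun p : Fin q × Fin q => whitened φ p.1 u * whitened φ p.2 v := by
  ext p
  have ht : ∀ l, sigmaInvSqrt φ l p.2 = sigmaInvSqrt φ p.2 l := fun l =>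
    congrFun (congrFun (sigmaInvSqrt_transpose (φ := φ)) p.2) l
  simp only [whitenVec, LinearMap.coe_mk, AddHom.coe_mk, Matrix.mul_apply, Matrix.of_apply,
    whitened, Finset.sum_mul_sum]
  rw [Finset.sum_comm]
  refine Finset.sum_congr rfl fun l _ => ?_
  rw [Finset.sum_mul]
  refine Finset.sum_congr rfl fun k _ => ?_
  rw [ht]
  ring

lemma sqrt_smul_whitenVec_rhoOracle (n : ℕ) (ω : ℕ → Obs d) :
    √(n : ℝ) • whitenVec φ (rhoOracle φ κ η n (truncate n ω)) =
      (√(n : ℝ))⁻¹ • ∑ i ∈ Finset.range n, score φ κ η (ω i) := by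
  have h1 : rhoOracle φ κ η n (truncate n ω) = (n : ℝ)⁻¹ • ∑ i ∈ Finset.range n,
      (Matrix.of fun k l => φ k (cdfI (κ (coordZ d (ω i))) (coordX d (ω i))) *
        φ l (cdfI (η (coordZ d (ω i))) (coordY d (ω i)))) := by
    ext k l
    rw [← Fin.sum_univ_eq_sum_range (fun i => Matrix.of fun k l =>
      φ k (cdfI (κ (coordZ d (ω i))) (coordX d (ω i))) *
        φ l (cdfI (η (coordZ d (ω i))) (coordY d (ω i))))]
    simp [rhoOracle, truncate, Matrix.sum_apply]
  have h2 : √(n : ℝ) * (n : ℝ)⁻¹ = (√(n : ℝ))⁻¹ := by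
    -- For `n = 0` both sides are zero, because `0⁻¹ = 0`.
    rcases Nat.eq_zero_or_pos n with rfl | hn
    · simp
    · have : 0 < √(n : ℝ) := Real.sqrt_pos.2 (by exact_mod_cast hn)
      nth_rewrite 2 [← Real.mul_self_sqrt (Nat.cast_nonneg n)]
      field_simp
  rw [h1, map_smul, map_sum, smul_smul, h2]
  congr 1
  exact Finset.sum_congr rfl fun i _ => whitenVec_outer _ _

lemma measurable_score (hφ : IsCorrelationMap φ) : Measurable (score φ κ η (d := d)) := by
  refine (WithLp.measurable_toLp 2 _).comp (measurable_pi_iff.2 fun p => Measurable.mul ?_ ?_)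
  · exact (continuous_whitened hφ _).measurable.comp ((measurable_cdfI κ).comp
      ((measurable_fst : Measurable (coordX d)).prodMk (measurable_coordZ d)))
  · exact (continuous_whitened hφ _).measurable.comp ((measurable_cdfI η).comp
      ((measurable_fst.comp measurable_snd : Measurable (coordY d)).prodMk (measurable_coordZ d)))

lemma measurable_rhoHat (hφ : IsCorrelationMap φ) (EX EY : CondCDFEstimator d) (n : ℕ)
    (k l : Fin q) : Measurable fun s : Fin n → Obs d => rhoHat φ EX EY n s k l := by
  refine Measurable.const_mul (Finset.measurable_sum _ fun i _ => Measurable.mul ?_ ?_) _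
  · exact (measurable_apply_est hφ EX k n i).comp (measurable_pi_iff.2 fun m =>
      ((measurable_fst : Measurable (coordX d)).prodMk (measurable_coordZ d)).comp
        (measurable_pi_apply m))
  · exact (measurable_apply_est hφ EY l n i).comp (measurable_pi_iff.2 fun m =>
      ((measurable_fst.comp measurable_snd : Measurable (coordY d)).prodMk
        (measurable_coordZ d)).comp (measurable_pi_apply m))

lemma measurable_whitenVec {α : Type*} [MeasurableSpace α] {A : α → Matrix (Fin q) (Fin q) ℝ}
    (hA : ∀ k l, Measurable fun a => A a k l) : Measurable fun a => whitenVec φ (A a) := by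
  refine (WithLp.measurable_toLp 2 _).comp (measurable_pi_iff.2 fun p => ?_)
  simp only [Matrix.mul_apply]
  fun_prop

lemma integrable_apply_cdfI_mul_apply_cdfI {f f' : I → ℝ} (hf : Continuous f)
    (hf' : Continuous f') : Integrable (fun w => f (cdfI (κ (coordZ d w)) (coordX d w)) *
      f' (cdfI (η (coordZ d w)) (coordY d w))) (P : Measure (Obs d)) := by
  have hX : Measurable (coordX d) := measurable_fst
  have hY : Measurable (coordY d) := measurable_fst.comp measurable_snd
  obtain ⟨C, hC⟩ := isCompact_univ.exists_bound_of_continuousOn hf.continuousOn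
  obtain ⟨C', hC'⟩ := isCompact_univ.exists_bound_of_continuousOn hf'.continuousOn
  refine Integrable.of_bound (Measurable.aestronglyMeasurable (Measurable.mul ?_ ?_)) (C * C')
    (ae_of_all _ fun w => ?_)
  · exact hf.measurable.comp ((measurable_cdfI κ).comp (hX.prodMk (measurable_coordZ d)))
  · exact hf'.measurable.comp ((measurable_cdfI η).comp (hY.prodMk (measurable_coordZ d)))
  · rw [norm_mul]
    exact mul_le_mul (hC _ (mem_univ _)) (hC' _ (mem_univ _)) (norm_nonneg _)
      ((norm_nonneg _).trans (hC 0 (mem_univ _)))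

lemma integral_coordX_coordY (hP : P ∈ condIndepLaws d)
    (hκ : IsCondLaw P (coordX d) κ) (hη : IsCondLaw P (coordY d) η) {f f' : I → ℝ}
    (hf : Continuous f) (hf' : Continuous f') :
    ∫ w, f (cdfI (κ (coordZ d w)) (coordX d w)) * f' (cdfI (η (coordZ d w)) (coordY d w))
      ∂(P : Measure (Obs d)) = (∫ u, f u) * ∫ u, f' u := by
  have hX : Measurable (coordX d) := measurable_fst
  have hY : Measurable (coordY d) := measurable_fst.comp measurable_snd
  exact integral_apply_cdfI_mul_apply_cdfI hX hY (map_eq_compProd_prod hX hY hκ hη hP.2)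
    (ae_nullSingletonClass hκ hX (map_coordX_absolutelyContinuous hP.1))
    (ae_nullSingletonClass hη hY (map_coordY_absolutelyContinuous hP.1)) hf hf'

lemma inner_score (t : EuclideanSpace ℝ (Fin q × Fin q)) (w : Obs d) :
    inner ℝ (score φ κ η w) t = ∑ p, t p *
      (whitened φ p.1 (cdfI (κ (coordZ d w)) (coordX d w)) *
        whitened φ p.2 (cdfI (η (coordZ d w)) (coordY d w))) := by
  simp [PiLp.inner_apply, score]

lemma integral_inner_score (hφ : IsCorrelationMap φ) (hP : P ∈ condIndepLaws d)
    (hκ : IsCondLaw P (coordX d) κ) (hη : IsCondLaw P (coordY d) η)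
    (t : EuclideanSpace ℝ (Fin q × Fin q)) :
    ∫ w, inner ℝ (score φ κ η w) t ∂(P : Measure (Obs d)) = 0 := by
  simp_rw [inner_score]
  rw [integral_finsetSum _ fun p _ => (integrable_apply_cdfI_mul_apply_cdfI
    (continuous_whitened hφ _) (continuous_whitened hφ _)).const_mul _]
  refine Finset.sum_eq_zero fun p _ => ?_
  rw [integral_const_mul, integral_coordX_coordY hP hκ hη (continuous_whitened hφ _)
    (continuous_whitened hφ _), integral_whitened hφ, zero_mul, mul_zero]

/-- The score has identity covariance: the expected product of two entries splits into two `L²`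
inner products of the orthonormal whitened system. -/
lemma integral_inner_score_sq (hφ : IsCorrelationMap φ) (hP : P ∈ condIndepLaws d)
    (hκ : IsCondLaw P (coordX d) κ) (hη : IsCondLaw P (coordY d) η)
    (t : EuclideanSpace ℝ (Fin q × Fin q)) :
    ∫ w, inner ℝ (score φ κ η w) t ^ 2 ∂(P : Measure (Obs d)) = ‖t‖ ^ 2 := by
  rw [EuclideanSpace.real_norm_sq_eq]
  have hcc : ∀ a b : Fin q, Continuous fun u => whitened φ a u * whitened φ b u := fun a b =>
    (continuous_whitened hφ a).mul (continuous_whitened hφ b)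
  -- The four factors are regrouped into one function of `U₁` times one function of `U₂`, to which
  -- the independence of the two applies.
  have hsq : ∀ w, inner ℝ (score φ κ η w) t ^ 2 = ∑ p, ∑ p', t p * t p' *
      ((fun u => whitened φ p.1 u * whitened φ p'.1 u) (cdfI (κ (coordZ d w)) (coordX d w)) *
        (fun u => whitened φ p.2 u * whitened φ p'.2 u)
          (cdfI (η (coordZ d w)) (coordY d w))) := fun w => by
    rw [inner_score, sq, Finset.sum_mul_sum]
    exact Finset.sum_congr rfl fun p _ => Finset.sum_congr rfl fun p' _ => by ring
  have hint : ∀ p p' : Fin q × Fin q, Integrable (fun w => t p * t p' *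
      ((fun u => whitened φ p.1 u * whitened φ p'.1 u) (cdfI (κ (coordZ d w)) (coordX d w)) *
        (fun u => whitened φ p.2 u * whitened φ p'.2 u)
          (cdfI (η (coordZ d w)) (coordY d w)))) (P : Measure (Obs d)) := fun p p' =>
    (integrable_apply_cdfI_mul_apply_cdfI (hcc _ _) (hcc _ _)).const_mul _
  have hval : ∀ p p' : Fin q × Fin q, ∫ w, t p * t p' *
      ((fun u => whitened φ p.1 u * whitened φ p'.1 u) (cdfI (κ (coordZ d w)) (coordX d w)) *
        (fun u => whitened φ p.2 u * whitened φ p'.2 u)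
          (cdfI (η (coordZ d w)) (coordY d w))) ∂(P : Measure (Obs d)) =
      if p = p' then t p ^ 2 else 0 := fun p p' => by
    rw [integral_const_mul, integral_coordX_coordY hP hκ hη (hcc _ _) (hcc _ _),
      integral_whitened_mul hφ, integral_whitened_mul hφ]
    by_cases h1 : p.1 = p'.1 <;> by_cases h2 : p.2 = p'.2
    · obtain rfl : p = p' := Prod.ext h1 h2
      simp [sq]
    all_goals simp [h1, h2, Prod.ext_iff]
  rw [integral_congr_ae (ae_of_all _ hsq),
    integral_finsetSum _ fun p _ => integrable_finsetSum _ fun p' _ => hint p p']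
  refine Finset.sum_congr rfl fun p _ => ?_
  rw [integral_finsetSum _ fun p' _ => hint p p', Finset.sum_congr rfl fun p' _ => hval p p']
  simp

lemma measurePreserving_eval_sequenceLaw (P : ProbabilityMeasure (Obs d)) (i : ℕ) :
    MeasurePreserving (fun ω : ℕ → Obs d => ω i) (sequenceLaw P) (P : Measure (Obs d)) :=
  measurePreserving_eval_infinitePi (fun _ : ℕ => (P : Measure (Obs d))) i

lemma identDistrib_score (hφ : IsCorrelationMap φ) (i : ℕ) :
    IdentDistrib (fun ω : ℕ → Obs d => score φ κ η (ω i)) (fun ω => score φ κ η (ω 0))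
      (sequenceLaw P) (sequenceLaw P) := by
  have hms := measurable_score (κ := κ) (η := η) hφ
  have h : IdentDistrib (fun ω : ℕ → Obs d => ω i) (fun ω => ω 0) (sequenceLaw P)
      (sequenceLaw P) :=
    ⟨(measurable_pi_apply i).aemeasurable, (measurable_pi_apply 0).aemeasurable,
      (measurePreserving_eval_sequenceLaw P i).map_eq.trans
        (measurePreserving_eval_sequenceLaw P 0).map_eq.symm⟩
  exact h.comp hms

lemma iIndepFun_score (hφ : IsCorrelationMap φ) :
    iIndepFun (fun (i : ℕ) ω => score φ κ η (ω i)) (sequenceLaw P) :=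
  iIndepFun_infinitePi (X := fun _ : ℕ => score φ κ η) fun _ => measurable_score hφ

lemma tendstoInDistribution_oracle (hφ : IsCorrelationMap φ) (hP : P ∈ condIndepLaws d)
    (hκ : IsCondLaw P (coordX d) κ) (hη : IsCondLaw P (coordY d) η) :
    TendstoInDistribution
      (fun (n : ℕ) ω => √(n : ℝ) • whitenVec φ (rhoOracle φ κ η n (truncate n ω))) atTop id
      (fun _ => sequenceLaw P) (stdGaussian (EuclideanSpace ℝ (Fin q × Fin q))) := by
  have hmap : ∀ F : Obs d → ℝ, Measurable F →
      ∫ ω, F (ω 0) ∂(sequenceLaw P) = ∫ w, F w ∂(P : Measure (Obs d)) := fun F hF => by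
    have h1 := integral_map (μ := sequenceLaw P) (φ := fun ω => ω 0)
      (measurable_pi_apply 0).aemeasurable hF.aestronglyMeasurable
    rw [← h1, (measurePreserving_eval_sequenceLaw P 0).map_eq]
  have hminner : ∀ t : EuclideanSpace ℝ (Fin q × Fin q),
      Measurable fun w : Obs d => inner ℝ (score φ κ η w) t := fun t =>
    (show Continuous fun x : EuclideanSpace ℝ (Fin q × Fin q) => inner ℝ x t by
      fun_prop).measurable.comp (measurable_score hφ)
  have hclt := tendstoInDistribution_inv_sqrt_smul_sum_stdGaussian (μ := sequenceLaw P)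
    (X := fun i ω => score φ κ η (ω i))
    (fun t => (hmap _ (hminner t)).trans (integral_inner_score hφ hP hκ hη t))
    (fun t => (hmap _ ((hminner t).pow_const 2)).trans (integral_inner_score_sq hφ hP hκ hη t))
    (iIndepFun_score hφ) (identDistrib_score hφ)
  exact hclt.congr (fun n => ae_of_all _ fun ω => (sqrt_smul_whitenVec_rhoOracle n ω).symm)
    (ae_of_all _ fun _ => rfl)

lemma tendstoInMeasure_whitenVec_sub (hq : 1 ≤ q) (hφ : IsCorrelationMap φ)
    (hP : P ∈ condIndepLaws d) (hκ : IsCondLaw P (coordX d) κ) (hη : IsCondLaw P (coordY d) η)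
    (hcons : IsConsistentWithRates φ EX EY P κ η g h)
    (hgh : Tendsto (fun n : ℕ => √(n : ℝ) * g n * h n) atTop (𝓝 0)) :
    TendstoInMeasure (sequenceLaw P)
      ((fun (n : ℕ) ω => √(n : ℝ) • whitenVec φ (rhoHat φ EX EY n (truncate n ω))) -
        fun (n : ℕ) ω => √(n : ℝ) • whitenVec φ (rhoOracle φ κ η n (truncate n ω))) atTop 0 := by
  rw [tendstoInMeasure_iff_norm]
  intro δ hδ
  -- Matrices are viewed as functions `Fin q → Fin q → ℝ`, whose sup norm is small once every entry
  -- is; continuity at zero then turns entrywise convergence into convergence of the whitened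
  -- vector.
  have hcont : Continuous (whitenVec φ ∘ₗ (Matrix.ofLinearEquiv ℝ).toLinearMap) :=
    LinearMap.continuous_of_finiteDimensional _
  obtain ⟨r, hr, hrδ⟩ := Metric.continuousAt_iff.1 (hcont.continuousAt (x := 0)) δ hδ
  have hlim : Tendsto (fun n : ℕ => ∑ p : Fin q × Fin q, sampleLaw P n {s | r ≤
      |√(n : ℝ) * (rhoHat φ EX EY n s p.1 p.2 - rhoOracle φ κ η n s p.1 p.2)|}) atTop (𝓝 0) := by
    have := tendsto_finsetSum (Finset.univ : Finset (Fin q × Fin q)) fun p _ =>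
      tendsto_measure_sqrt_mul_rhoHat_sub_rhoOracle hq hφ hP hκ hη hcons hgh p.1 p.2 hr
    simpa using this
  refine tendsto_of_tendsto_of_tendsto_of_le_of_le tendsto_const_nhds hlim
    (fun n => zero_le) fun n => ?_
  refine le_trans ?_ (measure_iUnion_fintype_le (sampleLaw P n) _)
  rw [← map_truncate_sequenceLaw]
  refine le_trans (measure_mono fun ω hω => ?_)
    (Measure.le_map_apply (measurable_truncate n).aemeasurable _)
  by_contra hcon
  simp only [mem_preimage, mem_iUnion, mem_ofPred_eq, not_exists, not_le] at hcon
  refine absurd (show δ ≤ _ from hω) (not_le.2 ?_)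
  set M : Fin q → Fin q → ℝ := fun k l => √(n : ℝ) * (rhoHat φ EX EY n (truncate n ω) k l -
    rhoOracle φ κ η n (truncate n ω) k l) with hM
  have hM1 : dist M 0 < r := by
    rw [dist_zero_right, pi_norm_lt_iff hr]
    exact fun k => (pi_norm_lt_iff hr).2 fun l => hcon (k, l)
  have hM2 : Matrix.ofLinearEquiv ℝ M = √(n : ℝ) • (rhoHat φ EX EY n (truncate n ω) -
      rhoOracle φ κ η n (truncate n ω)) := by
    ext k l
    simp [hM]
  have h1 := hrδ hM1
  rw [map_zero, dist_zero_right, LinearMap.comp_apply, LinearEquiv.coe_coe, hM2, map_smul, map_sub,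
    smul_sub] at h1
  simpa using h1

/-- Under conditional independence the whitened generalized correlation is asymptotically standard
normal. -/
theorem tendstoInDistribution_whitenVec_rhoHat (hq : 1 ≤ q) (hφ : IsCorrelationMap φ)
    (hP : P ∈ condIndepLaws d) (hκ : IsCondLaw P (coordX d) κ) (hη : IsCondLaw P (coordY d) η)
    (hcons : IsConsistentWithRates φ EX EY P κ η g h)
    (hgh : Tendsto (fun n : ℕ => √(n : ℝ) * g n * h n) atTop (𝓝 0)) :
    TendstoInDistribution
      (fun (n : ℕ) ω => √(n : ℝ) • whitenVec φ (rhoHat φ EX EY n (truncate n ω))) atTop id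
      (fun _ => sequenceLaw P) (stdGaussian (EuclideanSpace ℝ (Fin q × Fin q))) :=
  tendstoInDistribution_of_tendstoInMeasure_sub _ _ (tendstoInDistribution_oracle hφ hP hκ hη)
    (tendstoInMeasure_whitenVec_sub hq hφ hP hκ hη hcons hgh) fun n =>
    ((measurable_whitenVec (φ := φ) (A := fun ω => rhoHat φ EX EY n (truncate n ω)) fun k l =>
      (measurable_rhoHat hφ EX EY n k l).comp (measurable_truncate n)).const_smul (√(n : ℝ))).aemeasurable

lemma measurable_testStat (hφ : IsCorrelationMap φ) (EX EY : CondCDFEstimator d) (n : ℕ) :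
    Measurable (testStat φ EX EY n) := by
  have h : testStat φ EX EY n = fun s => ‖whitenVec φ (rhoHat φ EX EY n s)‖ ^ 2 :=
    funext fun s => (norm_sq_whitenVec _).symm
  rw [h]
  exact (measurable_whitenVec (measurable_rhoHat hφ EX EY n)).norm.pow_const 2

/-- Multiplying the rejection inequality by `n > 0` moves the scaling into the statistic, leaving a
fixed threshold. -/
lemma integral_correlationTest (hφ : IsCorrelationMap φ) (EX EY : CondCDFEstimator d) (α : ℝ)
    {n : ℕ} (hn : 1 ≤ n) :
    ∫ s, correlationTest φ EX EY α n s ∂(sampleLaw P n) =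
      (((sequenceLaw P).map fun ω =>
        ‖√(n : ℝ) • whitenVec φ (rhoHat φ EX EY n (truncate n ω))‖ ^ 2)
        (Ioi (realQuantile (chiSquared (q ^ 2)) (1 - α)))).toReal := by
  set z := realQuantile (chiSquared (q ^ 2)) (1 - α) with hz
  have hn0 : (0 : ℝ) < n := by exact_mod_cast hn
  have hS : MeasurableSet {s | (n : ℝ)⁻¹ * z < testStat φ EX EY n s} :=
    measurableSet_lt measurable_const (measurable_testStat hφ EX EY n)
  have h1 : correlationTest φ EX EY α n =
      {s | (n : ℝ)⁻¹ * z < testStat φ EX EY n s}.indicator fun _ => (1 : ℝ) := by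
    funext s
    simp only [correlationTest, indicator_apply, mem_ofPred_eq, ← hz]
  have hm : Measurable fun ω : ℕ → Obs d =>
      ‖√(n : ℝ) • whitenVec φ (rhoHat φ EX EY n (truncate n ω))‖ ^ 2 :=
    ((measurable_whitenVec fun k l => (measurable_rhoHat hφ EX EY n k l).comp
      (measurable_truncate n)).const_smul (√(n : ℝ))).norm.pow_const 2
  have h2 : (fun ω : ℕ → Obs d =>
      ‖√(n : ℝ) • whitenVec φ (rhoHat φ EX EY n (truncate n ω))‖ ^ 2) ⁻¹' Ioi z =
      truncate n ⁻¹' {s | (n : ℝ)⁻¹ * z < testStat φ EX EY n s} := by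
    ext ω
    simp only [mem_preimage, mem_Ioi, mem_ofPred_eq]
    rw [norm_smul, mul_pow, norm_sq_whitenVec, Real.norm_eq_abs, sq_abs, Real.sq_sqrt hn0.le,
      inv_mul_lt_iff₀ hn0]
    rfl
  rw [h1, integral_indicator hS, setIntegral_const, smul_eq_mul, mul_one, measureReal_def,
    ← map_truncate_sequenceLaw, Measure.map_apply (measurable_truncate n) hS,
    Measure.map_apply hm measurableSet_Ioi, h2]

/-- The rejection probability of the test converges to its nominal level under conditional
independence. -/
theorem tendsto_integral_correlationTest (hq : 1 ≤ q) (hφ : IsCorrelationMap φ)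
    (hP : P ∈ condIndepLaws d) (hκ : IsCondLaw P (coordX d) κ) (hη : IsCondLaw P (coordY d) η)
    (hcons : IsConsistentWithRates φ EX EY P κ η g h)
    (hgh : Tendsto (fun n : ℕ => √(n : ℝ) * g n * h n) atTop (𝓝 0))
    {α : ℝ} (hα : α ∈ Ioo (0 : ℝ) 1) :
    Tendsto (fun n : ℕ => ∫ s, correlationTest φ EX EY α n s ∂(sampleLaw P n)) atTop (𝓝 α) := by
  have hdist := (tendstoInDistribution_whitenVec_rhoHat hq hφ hP hκ hη hcons hgh).continuous_comp
    (g := fun x : EuclideanSpace ℝ (Fin q × Fin q) => ‖x‖ ^ 2) (by fun_prop)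
  have hnull := nullSingletonClass_chiSquared (k := q ^ 2) (Nat.one_le_pow _ _ hq)
  have hlaw : (stdGaussian (EuclideanSpace ℝ (Fin q × Fin q))).map (fun x => ‖x‖ ^ 2) =
      chiSquared (q ^ 2) :=
    map_norm_sq_stdGaussian (finProdFinEquiv.trans (finCongr (sq q).symm))
  set z := realQuantile (chiSquared (q ^ 2)) (1 - α) with hz
  -- The boundary of the rejection region is the single point `z`, null for the atomless limit law.
  have hport := ProbabilityMeasure.tendsto_measure_of_null_frontier_of_tendsto' hdist.tendsto
    (E := Ioi z) (by
      simp only [ProbabilityMeasure.coe_mk, Function.comp_id, hlaw, frontier_Ioi]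
      simp)
  simp only [ProbabilityMeasure.coe_mk, Function.comp_id, hlaw] at hport
  have hval : (chiSquared (q ^ 2) (Ioi z)).toReal = α := by
    have h1 := measureReal_Iic_realQuantile (chiSquared (q ^ 2)) (p := 1 - α)
      ⟨by linarith [hα.2], by linarith [hα.1]⟩
    rw [← measureReal_def, ← compl_Iic, probReal_compl_eq_one_sub measurableSet_Iic, h1]
    ring
  have h2 := (ENNReal.tendsto_toReal (measure_ne_top (chiSquared (q ^ 2)) (Ioi z))).comp hport
  rw [hval] at h2
  refine h2.congr' ?_
  filter_upwards [eventually_ge_atTop 1] with n hn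
  rw [integral_correlationTest hφ EX EY α hn]
  rfl

end Asymptotics

end PartialCopula

/-- Asymptotic pointwise level of the partial copula test based on the generalized correlation. -/
theorem corollary4p6 (d q : ℕ) (hq : 1 ≤ q)
    (φ : Fin q → unitInterval → ℝ) (hφ : IsCorrelationMap φ)
    (P₀ : Set (ProbabilityMeasure (Obs d))) (hP₀ : P₀ ⊆ absContLaws d)
    (κX κY : ProbabilityMeasure (Obs d) → Kernel (Cube d) unitInterval)
    (hκX : ∀ P ∈ P₀, IsCondLaw P (coordX d) (κX P))
    (hκY : ∀ P ∈ P₀, IsCondLaw P (coordY d) (κY P))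
    (EX EY : CondCDFEstimator d)
    (hcons : ∀ P ∈ P₀, ∃ g h : ℕ → ℝ,
      IsConsistentWithRates φ EX EY P (κX P) (κY P) g h ∧
      Tendsto (fun n : ℕ => √(n : ℝ) * g n * h n) atTop (𝓝 0))
    (α : ℝ) (hα : α ∈ Set.Ioo (0 : ℝ) 1) :
    ∀ P ∈ P₀ ∩ condIndepLaws d,
      limsup (fun n : ℕ => ∫ s, correlationTest φ EX EY α n s ∂(sampleLaw P n)) atTop = α := by
  rintro P ⟨hP, hPH⟩
  obtain ⟨g, h, hcons, hgh⟩ := hcons P hP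
  have := (hκX P hP).1
  have := (hκY P hP).1
  exact (tendsto_integral_correlationTest hq hφ hPH (hκX P hP) (hκY P hP) hcons hgh hα).limsup_eq
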